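/- Let $q\in\{2,3\}$, $d_2=6$, $d_3=2$. For nonzero $F,G\in\mathbb F_q[T]$ put $\varphi(F)=\#(\mathbb F_q[T]/(F))^*$ and $\sigma(G)=\sum_{D\mid G,\ D\text{ monic}}q^{\deg D}$. For a tuple $\mathbf v=(v_0,v_1,\dots,v_m)$ of positive integers with $m\ge 1$, let $V_q(\mathbf v)$ be the set of pairs $(F,G)$ such that there are monic irreducible polynomials $P_1,\dots,P_{m+1}$ with $\deg P_k=v_0\prod_{i=1}^{k-1}(v_i+1)$, $F=P_{m+1}$ and $G=\prod_{i=1}^m P_i^{v_i}$. Call $\mathbf v$ reduced if $v_0(v_1+1)\nmid d_q$ (when $v_0\mid d_q$, this says that $P_1$ is the only one of the $P_k$ whose degree divides $d_q$). Let $E_q$ be the set of pairs $(F_0,G_0)$ of nonzero polynomials such that $F_0$ is squarefree, every prime factor of $F_0$ has degree dividing $d_q$, and $(e+1)\deg P\mid d_q$ whenever $P$ is irreducible, $e\ge1$ and $P^e$ exactly divides $G_0$. A decomposition of $(F,G)$ of type $(\mathbf v_1,\dots,\mathbf v_n)$, $n\ge0$, with $\mathbf v_i=(v_{i,0},v_{i,1},\dots)$,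 is a pair of factorizations $F=\prod_{i=0}^nF_i$, $G=\prod_{i=0}^nG_i$ with $\gcd(F_i,F_j)=\gcd(G_i,G_j)=1$ for $i\ne j$, and, for $1\le i\le n$, $(F_i,G_i)\in V_q(\mathbf v_i)$ and $v_{i,0}\mid d_q$. Say that $(\mathbf v_1,\dots,\mathbf v_n)$ occurs if some monic $F,G$ with $\varphi(F)=\sigma(G)$ have a decomposition of this type with $(F_0,G_0)\in E_q$. The set $E_q$ is finite, and all nonzero $F,G$ with $\varphi(F)=\sigma(G)$ have a decomposition with $(F_0,G_0)\in E_q$ and all $\mathbf v_i$ reduced. Moreover: 1. Let $q=3$. If $\varphi(F)=\sigma(G)$ with $F,G\neq 0$, then every decomposition of $(F,G)$ (whether or not $(F_0,G_0)\in E_3$) has $n\le2$. Conversely, for each $n\le 2$, all tuples $\mathbf v_1,\dots,\mathbf v_n$ with $v_{i,0}\mid2$ for all $i$ occur. 2. Let $q=2$. If $\varphi(F)=\sigma(G)$ with $F,G\neq 0$, then every decomposition of $(F,G)$ (whether or not $(F_0,G_0)\in E_2$) has $n\le3$; moreover there are no indices $i\ne j$ with $v_{i,0}=v_{j,0}=2$,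 and if $n=3$ then $(v_{1,0},v_{2,0},v_{3,0})\neq(1,1,1)$. Conversely: the empty family ($n=0$) occurs, and for $n=1$ every $\mathbf v_1$ with $v_{1,0}\mid 6$ occurs; for $n=2$ all reduced $\mathbf v_1,\mathbf v_2$ with $v_{1,0},v_{2,0}\mid 6$ occur except when $(v_{1,0},v_{2,0})=(2,2)$; for $n=3$ all reduced $\mathbf v_1,\mathbf v_2,\mathbf v_3$ with $v_{1,0},v_{2,0}\mid6$ and $v_{3,0}=1$ occur except when $(v_{1,0},v_{2,0})=(2,2)$ or $(v_{1,0},v_{2,0},v_{3,0})=(1,1,1)$. -/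

import Mathlib

open scoped Polynomial

namespace PhiSigma

/-- The norm `|A| = q ^ deg A` of a polynomial over the field with `q` elements. -/
noncomputable def norm (K : Type*) [Field K] (A : K[X]) : ℕ :=
  Nat.card K ^ A.natDegree

/-- Euler's function `φ(F) = #(K[T]/(F))ˣ`. -/
noncomputable def phi (K : Type*) [Field K] (F : K[X]) : ℕ :=
  Nat.card (K[X] ⧸ Ideal.span {F})ˣ

/-- The sum of divisors function `σ(G) = ∑ |D|` over the monic divisors `D` of `G`
(a finite sum when `K` is finite and `G ≠ 0`). -/
noncomputable def sigma (K : Type*) [Field K] (G : K[X]) : ℕ :=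
  ∑ᶠ D ∈ {D : K[X] | D.Monic ∧ D ∣ G}, norm K D

/-- A tuple `(v_0, v_1, …, v_m)` of positive integers with `m ≥ 1`; here `m` is `len`,
and the values of `val` beyond the index `len` play no role. -/
structure ExpTuple where
  len : ℕ
  val : ℕ → ℕ
  one_le_len : 1 ≤ len
  val_pos : ∀ i ≤ len, 0 < val i

/-- The degree `v_0 * ∏_{i=1}^{k-1} (v_i + 1)` prescribed for the `k`-th prime of a chain. -/
def ExpTuple.deg (v : ExpTuple) (k : ℕ) : ℕ :=
  v.val 0 * ∏ i ∈ Finset.Ico 1 k, (v.val i + 1)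

/-- `v` is reduced for `d` if `v_0 (v_1 + 1) ∤ d`; when `v_0 ∣ d`, this means that the first prime
of a chain is the only one whose degree divides `d`. -/
def ExpTuple.Reduced (d : ℕ) (v : ExpTuple) : Prop :=
  ¬ v.val 0 * (v.val 1 + 1) ∣ d

/-- The set `V_q(v)` of pairs `(F, G)` with `G = ∏_{k=1}^m P_k ^ v_k`, `F = P_{m+1}`, for (monic)
primes `P_1, …, P_{m+1}` of degree `deg P_k = v_0 * ∏_{i=1}^{k-1} (v_i + 1)`. -/
def chainSet (K : Type*) [Field K] (v : ExpTuple) : Set (K[X] × K[X]) :=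
  {p | ∃ P : ℕ → K[X],
    (∀ k ∈ Finset.Icc 1 (v.len + 1),
      (P k).Monic ∧ Irreducible (P k) ∧ (P k).natDegree = v.deg k) ∧
    p.1 = P (v.len + 1) ∧
    p.2 = ∏ k ∈ Finset.Icc 1 v.len, P k ^ v.val k}

/-- The exceptional pairs `(F_0, G_0)`: `F_0` is squarefree with all prime factors of degree
dividing `d`, and `(e + 1) deg P ∣ d` whenever `P ^ e` exactly divides `G_0`, `e ≥ 1`. -/
def exceptionalSet (K : Type*) [Field K] (d : ℕ) : Set (K[X] × K[X]) :=
  {p | Squarefree p.1 ∧ (∀ P : K[X], Irreducible P → P ∣ p.1 → P.natDegree ∣ d) ∧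
    p.2 ≠ 0 ∧ (∀ (P : K[X]) (e : ℕ), Irreducible P → 0 < e → P ^ e ∣ p.2 → ¬ P ^ (e + 1) ∣ p.2 →
      (e + 1) * P.natDegree ∣ d)}

/-- `F = F_0 F_1 ⋯ F_n` and `G = G_0 G_1 ⋯ G_n` with the `F_i` pairwise coprime, the `G_i` pairwise
coprime, and `(F_i, G_i) ∈ V_q(v_i)`, `v_{i,0} ∣ d` for `1 ≤ i ≤ n`. -/
structure IsDecomposition {K : Type*} [Field K] (d : ℕ) (F G : K[X]) {n : ℕ}
    (v : Fin n → ExpTuple) (A B : Fin (n + 1) → K[X]) : Prop where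
  prod_left : F = ∏ i, A i
  prod_right : G = ∏ i, B i
  coprime_left : ∀ i j, i ≠ j → IsCoprime (A i) (A j)
  coprime_right : ∀ i j, i ≠ j → IsCoprime (B i) (B j)
  mem_chainSet : ∀ i : Fin n, (A i.succ, B i.succ) ∈ chainSet K (v i)
  dvd : ∀ i : Fin n, (v i).val 0 ∣ d

/-- The family `v_1, …, v_n` occurs: some solution of `φ(F) = σ(G)` in monic polynomials
has a decomposition with exactly these tuples and with an exceptional pair `(F_0, G_0)`. -/
def Occurs (K : Type*) [Field K] (d : ℕ) {n : ℕ} (v : Fin n → ExpTuple) : Prop :=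
  ∃ (F G : K[X]) (A B : Fin (n + 1) → K[X]), F.Monic ∧ G.Monic ∧ phi K F = sigma K G ∧
    IsDecomposition d F G v A B ∧ (A 0, B 0) ∈ exceptionalSet K d

/-- The exceptional set is finite, and every solution of `φ(F) = σ(G)` in nonzero polynomials has a
decomposition (with reduced tuples) whose pair `(F_0, G_0)` is exceptional. -/
def HasDecompositions (K : Type*) [Field K] (d : ℕ) : Prop :=
  (exceptionalSet K d).Finite ∧
  ∀ F G : K[X], F ≠ 0 → G ≠ 0 → phi K F = sigma K G →
    ∃ (n : ℕ) (v : Fin n → ExpTuple) (A B : Fin (n + 1) → K[X]),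
      IsDecomposition d F G v A B ∧ (A 0, B 0) ∈ exceptionalSet K d ∧ ∀ i, (v i).Reduced d

end PhiSigma

/-!
`σ(G)` is prime to the characteristic, so `F` is squarefree; write `F = ∏ P_i`, `G = ∏ Q_j ^ e_j`.
Then `φ(F) = σ(G)` reads
`∏ (q ^ deg P_i - 1) * ∏ (q ^ deg Q_j - 1) = ∏ (q ^ ((e_j + 1) deg Q_j) - 1)`.
By Zsigmondy's theorem `q ^ k - 1` has a primitive prime divisor for every `k ∤ d_q`, so by
descending induction on `k` each exponent `k ∤ d_q` occurs equally often on both sides. Matching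
each `Q_j` such that `k = (e_j + 1) deg Q_j ∤ d_q` with a prime of `F` or `G` of degree `k`, and
iterating, splits the solution into chains; what remains is `(F_0, G_0)`. The factors of a chain
telescope to `q ^ v_0 - 1`, so what is left is `φ(F_0) ∏ (q ^ v_{i,0} - 1) = σ(G_0)`, which
involves only degrees dividing `d_q`. Comparing 2-adic (`q = 3`) or 7-adic (`q = 2`) valuations
with the number of primes of small degree bounds `n`. Conversely, a solution of this numerical
equation that asks for no more primes of each degree than exist is realised by choosing distinct
primes.
-/

namespace PhiSigma

section PrimitivePrimes

open Polynomial

/-- `r` is a primitive prime divisor of `q ^ n - 1`: a prime for which `q` has order exactly `n`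
modulo `r`. -/
structure IsPrimitivePrime (q n r : ℕ) : Prop where
  prime : r.Prime
  dvd_pow_sub_one_iff : ∀ m, r ∣ q ^ m - 1 ↔ n ∣ m

theorem natCast_pow_eq_one_iff {q r j : ℕ} (hq : 0 < q) :
    (q : ZMod r) ^ j = 1 ↔ r ∣ q ^ j - 1 := by
  rw [← ZMod.natCast_eq_zero_iff, Nat.cast_sub (Nat.one_le_pow _ _ hq), sub_eq_zero,
    Nat.cast_pow, Nat.cast_one]

theorem isPrimitivePrime_of_isPrimitiveRoot {q n r : ℕ} (hq : 0 < q) (hr : r.Prime)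
    (h : IsPrimitiveRoot (q : ZMod r) n) : IsPrimitivePrime q n r :=
  ⟨hr, fun m => by rw [← natCast_pow_eq_one_iff hq, h.pow_eq_one_iff_dvd]⟩

theorem exists_eq_pow_mul_of_dvd_cyclotomic_eval {q n r : ℕ} (hn : 0 < n) (hr : r.Prime)
    (h : (r : ℤ) ∣ (cyclotomic n ℤ).eval (q : ℤ)) :
    ∃ k m, n = r ^ k * m ∧ ¬ r ∣ m ∧ IsPrimitiveRoot (q : ZMod r) m := by
  have := Fact.mk hr
  obtain ⟨k, m, hm, rfl⟩ := Nat.exists_eq_pow_mul_and_not_dvd hn.ne' r hr.ne_one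
  refine ⟨k, m, rfl, hm, ?_⟩
  have : NeZero (m : ZMod r) := ⟨by rwa [Ne, ZMod.natCast_eq_zero_iff]⟩
  rw [← isRoot_cyclotomic_prime_pow_mul_iff_of_charP (p := r) (k := k), IsRoot.def]
  have heval := cyclotomic.eval_apply (q : ℤ) (r ^ k * m) (Int.castRingHom (ZMod r))
  rw [eq_intCast, eq_intCast, Int.cast_natCast,
    (ZMod.intCast_zmod_eq_zero_iff_dvd _ r).2 h] at heval
  exact heval

theorem IsPrimitivePrime.of_dvd_cyclotomic_eval {q n r : ℕ} (hq : 0 < q) (hn : 0 < n)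
    (hr : r.Prime) (h : (r : ℤ) ∣ (cyclotomic n ℤ).eval (q : ℤ)) (hrn : ¬ r ∣ n) :
    IsPrimitivePrime q n r := by
  obtain ⟨k, m, rfl, -, hprim⟩ := exists_eq_pow_mul_of_dvd_cyclotomic_eval hn hr h
  obtain rfl : k = 0 := by
    by_contra hk
    exact hrn ((dvd_pow_self r hk).mul_right m)
  rw [pow_zero, one_mul]
  exact isPrimitivePrime_of_isPrimitiveRoot hq hr hprim

theorem le_of_prime_dvd_of_dvd_cyclotomic_eval {q n r s : ℕ} (hn : 0 < n) (hr : r.Prime)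
    (h : (r : ℤ) ∣ (cyclotomic n ℤ).eval (q : ℤ)) (hs : s.Prime) (hsn : s ∣ n) : s ≤ r := by
  have := Fact.mk hr
  obtain ⟨k, m, rfl, hm, hprim⟩ := exists_eq_pow_mul_of_dvd_cyclotomic_eval hn hr h
  rcases hs.dvd_mul.1 hsn with hsr | hsm
  · exact Nat.le_of_dvd hr.pos (hs.dvd_of_dvd_pow hsr)
  · have hm0 : m ≠ 0 := by rintro rfl; exact hm (dvd_zero r)
    have hq0 : (q : ZMod r) ≠ 0 := (hprim.isUnit hm0).ne_zero
    have hmr : m ∣ r - 1 := hprim.dvd_of_pow_eq_one _ (ZMod.pow_card_sub_one_eq_one hq0)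
    exact (Nat.le_of_dvd (Nat.sub_pos_of_lt hr.one_lt) (hsm.trans hmr)).trans (Nat.sub_le _ _)

theorem dvd_pow_div_sub_one_of_dvd_cyclotomic_eval {q n r : ℕ} (hq : 0 < q) (hn : 0 < n)
    (hr : r.Prime) (h : (r : ℤ) ∣ (cyclotomic n ℤ).eval (q : ℤ)) (hrn : r ∣ n) :
    r ∣ q ^ (n / r) - 1 := by
  obtain ⟨k, m, rfl, hm, hprim⟩ := exists_eq_pow_mul_of_dvd_cyclotomic_eval hn hr h
  obtain ⟨j, rfl⟩ : ∃ j, k = j + 1 := by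
    refine Nat.exists_eq_succ_of_ne_zero ?_
    rintro rfl
    exact hm (by simpa using hrn)
  rw [← natCast_pow_eq_one_iff hq, hprim.pow_eq_one_iff_dvd, pow_succ, mul_right_comm,
    Nat.mul_div_cancel _ hr.pos]
  exact dvd_mul_left m _

theorem cyclotomic_eval_mul_dvd {q n r : ℕ} (hn : 0 < n) (hr : r.Prime) (hrn : r ∣ n) :
    (cyclotomic n ℤ).eval (q : ℤ) * ((q : ℤ) ^ (n / r) - 1) ∣ (q : ℤ) ^ n - 1 := by
  have hdvd := X_pow_sub_one_mul_cyclotomic_dvd_X_pow_sub_one_of_dvd ℤ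
    (Nat.mem_properDivisors.2 ⟨Nat.div_dvd_of_dvd hrn, Nat.div_lt_self hn hr.one_lt⟩)
  simpa [mul_comm] using (evalRingHom (q : ℤ)).map_dvd hdvd

/-- Lifting the exponent: `q ^ n - 1` has just one factor `r` more than `q ^ (n / r) - 1`. -/
theorem sq_not_dvd_cyclotomic_eval_of_odd {q n r : ℕ} (hq : 1 < q) (hn : 0 < n) (hr : r.Prime)
    (hodd : Odd r) (hrn : r ∣ n) : ¬ (r : ℤ) ^ 2 ∣ (cyclotomic n ℤ).eval (q : ℤ) := by
  intro hsq
  have := Fact.mk hr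
  have hrx := dvd_pow_div_sub_one_of_dvd_cyclotomic_eval (by omega) hn hr
    ((dvd_pow_self _ two_ne_zero).trans hsq) hrn
  have hdvd := (mul_dvd_mul_right hsq _).trans (cyclotomic_eval_mul_dvd (q := q) hn hr hrn)
  have hqn : q ^ n = (q ^ (n / r)) ^ r := by rw [← pow_mul, Nat.div_mul_cancel hrn]
  have hx : 1 < q ^ (n / r) :=
    Nat.one_lt_pow (Nat.div_pos (Nat.le_of_dvd hn hrn) hr.pos).ne' hq
  have hdvdNat : r ^ 2 * (q ^ (n / r) - 1) ∣ q ^ n - 1 := by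
    zify [hx.le, Nat.one_le_pow n q (by omega)]
    exact hdvd
  rw [hqn] at hdvdNat
  generalize q ^ (n / r) = x at hrx hx hdvdNat
  have hnrx : ¬ r ∣ x := fun h =>
    hr.one_lt.ne' (Nat.dvd_one.1 ((Nat.dvd_sub_iff_right hx.le h).1 hrx))
  have hval := padicValNat.pow_sub_pow hodd hx hrx hnrx hr.ne_zero
  have hle : padicValNat r (r ^ 2 * (x - 1)) ≤ padicValNat r (x ^ r - 1) :=
    (padicValNat_dvd_iff_le (Nat.sub_ne_zero_of_lt (Nat.one_lt_pow hr.ne_zero hx))).1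
      (pow_padicValNat_dvd.trans hdvdNat)
  rw [padicValNat.mul (pow_ne_zero _ hr.ne_zero) (Nat.sub_ne_zero_of_lt hx),
    padicValNat.prime_pow] at hle
  rw [one_pow, padicValNat_self] at hval
  omega

theorem four_not_dvd_cyclotomic_eval {q n : ℕ} (hn : 2 < n) :
    ¬ (4 : ℤ) ∣ (cyclotomic n ℤ).eval (q : ℤ) := by
  intro h4
  obtain ⟨k, m, rfl, hm, hprim⟩ := exists_eq_pow_mul_of_dvd_cyclotomic_eval (q := q) (by omega)
    Nat.prime_two (dvd_trans (by norm_num) h4)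
  have hm0 : m ≠ 0 := by rintro rfl; exact hm (dvd_zero 2)
  have hq1 : (q : ZMod 2) = 1 := by
    have hcases : ∀ x : ZMod 2, x ≠ 0 → x = 1 := by decide
    exact hcases _ (hprim.isUnit hm0).ne_zero
  obtain rfl : m = 1 := Nat.dvd_one.1 (hprim.dvd_of_pow_eq_one 1 (by rw [hq1, pow_one]))
  obtain ⟨j, rfl⟩ : ∃ j, k = j + 2 := by
    refine Nat.exists_eq_add_of_le' ?_
    by_contra! hk
    interval_cases k <;> omega
  have hsq : ((q : ℤ) ^ 2) % 4 = 1 :=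
    Int.sq_mod_four_eq_one_of_odd (by exact_mod_cast ZMod.natCast_eq_one_iff_odd.1 hq1)
  have hpow : (4 : ℤ) ∣ ((q : ℤ) ^ 2) ^ 2 ^ j - 1 :=
    dvd_trans (by omega) (sub_one_dvd_pow_sub_one _ _)
  rw [mul_one, cyclotomic_prime_pow_eq_geom_sum Nat.prime_two, eval_finsetSum,
    Finset.sum_range_succ, Finset.sum_range_one, pow_zero, eval_one, pow_one, eval_pow, eval_X,
    pow_succ', pow_mul] at h4
  omega

theorem sq_not_dvd_cyclotomic_eval {q n r : ℕ} (hq : 1 < q) (hn : 2 < n) (hr : r.Prime)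
    (hrn : r ∣ n) : ¬ (r : ℤ) ^ 2 ∣ (cyclotomic n ℤ).eval (q : ℤ) := by
  rcases hr.eq_two_or_odd' with rfl | hodd
  · exact four_not_dvd_cyclotomic_eval hn
  · exact sq_not_dvd_cyclotomic_eval_of_odd hq (by omega) hr hodd hrn

/-- Every prime divisor of `Φ_n(q)` is the largest prime factor of `n`, and divides `Φ_n(q)` just
once. -/
theorem exists_prime_cyclotomic_eval_eq {q n : ℕ} (hq : 1 < q) (hn : 2 < n)
    (h : ¬ ∃ r, IsPrimitivePrime q n r) :
    ∃ r : ℕ, r.Prime ∧ r ∣ n ∧ (cyclotomic n ℤ).eval (q : ℤ) = r := by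
  have hn0 : 0 < n := by omega
  obtain ⟨N, hN⟩ := Int.eq_ofNat_of_zero_le
    (cyclotomic_pos' n (by exact_mod_cast hq : (1 : ℤ) < q)).le
  have hN1 : 1 < N := by
    have hlt := sub_one_lt_natAbs_cyclotomic_eval (by omega : 1 < n) hq.ne'
    rw [hN, Int.natAbs_natCast] at hlt
    omega
  have dvd_eval {r : ℕ} (hr : r ∣ N) : (r : ℤ) ∣ (cyclotomic n ℤ).eval (q : ℤ) := by
    rw [hN]
    exact_mod_cast hr
  have dvd_n {r : ℕ} (hr : r.Prime) (hrN : r ∣ N) : r ∣ n := by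
    by_contra hrn
    exact h ⟨r, .of_dvd_cyclotomic_eval (by omega) hn0 hr (dvd_eval hrN) hrn⟩
  obtain ⟨r, hr, hrN⟩ := Nat.exists_prime_and_dvd hN1.ne'
  have hpow : N = r ^ N.primeFactorsList.length :=
    Nat.eq_prime_pow_of_unique_prime_dvd (by omega) fun {s} hs hsN => le_antisymm
      (le_of_prime_dvd_of_dvd_cyclotomic_eval hn0 hr (dvd_eval hrN) hs (dvd_n hs hsN))
      (le_of_prime_dvd_of_dvd_cyclotomic_eval hn0 hs (dvd_eval hsN) hr (dvd_n hr hrN))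
  have hlen : N.primeFactorsList.length < 2 := by
    by_contra! hle
    have hsq : r ^ 2 ∣ N := (pow_dvd_pow r hle).trans hpow.symm.dvd
    exact sq_not_dvd_cyclotomic_eval hq hn hr (dvd_n hr hrN) (by exact_mod_cast dvd_eval hsq)
  have hlen' : N.primeFactorsList.length = 1 := by
    interval_cases N.primeFactorsList.length <;> simp_all
  exact ⟨r, hr, dvd_n hr hrN, by rw [hN, hpow, hlen', pow_one]⟩

theorem cyclotomic_eval_natCast_real (q n : ℕ) :
    (cyclotomic n ℝ).eval (q : ℝ) = ((cyclotomic n ℤ).eval (q : ℤ) : ℤ) := by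
  simpa using cyclotomic.eval_apply (q : ℤ) n (algebraMap ℤ ℝ)

theorem exists_isPrimitivePrime_of_three_le {q n : ℕ} (hq : 3 ≤ q) (hn : 2 < n) :
    ∃ r, IsPrimitivePrime q n r := by
  by_contra h
  obtain ⟨r, hr, hrn, heval⟩ := exists_prime_cyclotomic_eval_eq (by omega) hn h
  have hlt : 2 ^ n.totient < r := by
    have hq' : (3 : ℝ) ≤ q := by exact_mod_cast hq
    have hlt := sub_one_pow_totient_lt_cyclotomic_eval (n := n) (q := (q : ℝ)) (by omega)
      (by linarith)
    rw [cyclotomic_eval_natCast_real, heval] at hlt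
    have hle : (2 : ℝ) ^ n.totient ≤ ((q : ℝ) - 1) ^ n.totient :=
      pow_le_pow_left₀ zero_le_two (by linarith) _
    exact_mod_cast hle.trans_lt hlt
  have hle : r - 1 ≤ n.totient := by
    rw [← Nat.totient_prime hr]
    exact Nat.le_of_dvd (Nat.totient_pos.2 (by omega)) (Nat.totient_dvd_of_dvd hrn)
  have hlt' : n.totient < 2 ^ n.totient := Nat.lt_two_pow_self
  omega

theorem lt_cyclotomic_eval_two_of_sq_dvd {n r : ℕ} (hn : 0 < n) (hr : r.Prime) (hr3 : 3 ≤ r)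
    (h : r ^ 2 ∣ n) : (r : ℝ) < (cyclotomic n ℝ).eval 2 := by
  obtain ⟨m, rfl⟩ : ∃ m, n = r * m * r := h.imp fun m hm => by rw [hm]; ring
  have hpow : (r : ℝ) + 1 < 2 ^ r := by
    have hlt : r - 1 < 2 ^ (r - 1) := Nat.lt_two_pow_self
    have heq : 2 ^ r = 2 * 2 ^ (r - 1) := by rw [← pow_succ', Nat.sub_add_cancel hr.one_lt.le]
    exact_mod_cast (by omega : r + 1 < 2 ^ r)
  have hr0 : (0 : ℝ) < r := by exact_mod_cast hr.pos
  calc (r : ℝ) < 2 ^ r - 1 := by linarith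
    _ ≤ ((2 : ℝ) ^ r - 1) ^ (r * m).totient :=
        le_self_pow₀ (by linarith [show (3 : ℝ) ≤ r by exact_mod_cast hr3])
          (Nat.totient_pos.2 (Nat.pos_of_mul_pos_right hn)).ne'
    _ ≤ (cyclotomic (r * m) ℝ).eval (2 ^ r) :=
        sub_one_pow_totient_le_cyclotomic_eval (by linarith) _
    _ = (cyclotomic (r * m * r) ℝ).eval 2 := by
        rw [← cyclotomic_expand_eq_cyclotomic hr (dvd_mul_right r m), expand_eval]

theorem three_mul_add_one_lt_two_pow {t : ℕ} (ht : 5 ≤ t) : 3 * t + 1 < 2 ^ t := by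
  induction t, ht using Nat.le_induction with
  | base => norm_num
  | succ t ht ih => rw [pow_succ]; omega

theorem lt_cyclotomic_eval_two_of_five_le {m r : ℕ} (hm : 0 < m) (hr : r.Prime) (hr5 : 5 ≤ r)
    (hrm : ¬ r ∣ m) : (r : ℝ) < (cyclotomic (m * r) ℝ).eval 2 := by
  have hpow : (r : ℝ) * 3 < 2 ^ r - 1 := by
    have : (3 : ℝ) * r + 1 < 2 ^ r := by exact_mod_cast three_mul_add_one_lt_two_pow hr5
    linarith
  have hr5' : (5 : ℝ) ≤ r := by exact_mod_cast hr5
  have htot : m.totient ≠ 0 := (Nat.totient_pos.2 hm).ne'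
  have hupper := cyclotomic_eval_le_add_one_pow_totient (q := 2) (by norm_num) m
  norm_num at hupper
  have hpos : 0 < (cyclotomic m ℝ).eval 2 := cyclotomic_pos' m one_lt_two
  refine lt_of_mul_lt_mul_right ?_ hpos.le
  calc (r : ℝ) * (cyclotomic m ℝ).eval 2 ≤ r ^ m.totient * 3 ^ m.totient :=
        mul_le_mul (le_self_pow₀ (by linarith) htot) hupper hpos.le (by positivity)
    _ < (2 ^ r - 1) ^ m.totient := by
        rw [← mul_pow]
        exact pow_lt_pow_left₀ hpow (by positivity) htot
    _ ≤ (cyclotomic m ℝ).eval (2 ^ r) :=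
        sub_one_pow_totient_le_cyclotomic_eval (by linarith) _
    _ = (cyclotomic (m * r) ℝ).eval 2 * (cyclotomic m ℝ).eval 2 := by
        rw [← eval_mul, ← cyclotomic_expand_eq_cyclotomic_mul hr hrm, expand_eval]

theorem exists_isPrimitivePrime_two {n : ℕ} (hn : 0 < n) (hn6 : ¬ n ∣ 6) :
    ∃ r, IsPrimitivePrime 2 n r := by
  by_contra h
  have hn2 : 2 < n := by
    by_contra!
    interval_cases n <;> simp at hn6
  obtain ⟨r, hr, hrn, heval⟩ := exists_prime_cyclotomic_eval_eq one_lt_two hn2 h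
  obtain ⟨k, m, hnk, hrm, hprim⟩ :=
    exists_eq_pow_mul_of_dvd_cyclotomic_eval hn hr (dvd_of_eq heval.symm)
  have hevalℝ := cyclotomic_eval_natCast_real 2 n
  rw [heval, Nat.cast_ofNat, Int.cast_natCast] at hevalℝ
  have hm : m ≠ 0 := by rintro rfl; exact hrm (dvd_zero r)
  have hr3 : 3 ≤ r := by
    have := Fact.mk hr
    have hne : r ≠ 2 := by
      rintro rfl
      exact (hprim.isUnit hm).ne_zero (ZMod.natCast_self 2)
    have := hr.two_le
    omega
  have hk : k < 2 := by
    by_contra! hk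
    have hsq : r ^ 2 ∣ n := hnk ▸ (pow_dvd_pow r hk).mul_right m
    exact (lt_cyclotomic_eval_two_of_sq_dvd hn hr hr3 hsq).ne' hevalℝ
  obtain rfl : k = 1 := by
    interval_cases k
    · rw [hnk, pow_zero, one_mul] at hrn
      exact absurd hrn hrm
    · rfl
  rw [pow_one, mul_comm] at hnk
  subst hnk
  rcases Nat.lt_or_ge r 5 with hr5 | hr5
  · interval_cases r
    · exact hn6 (mul_dvd_mul (hprim.dvd_of_pow_eq_one 2 (by decide)) (dvd_refl 3) : m * 3 ∣ 2 * 3)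
    · exact absurd hr (by decide)
  · exact (lt_cyclotomic_eval_two_of_five_le (by omega) hr hr5 hrm).ne' hevalℝ

/-- All exceptions to Zsigmondy's theorem for the base `q` divide `d`: if `n ∤ d`, then `q ^ n - 1`
has a primitive prime divisor. -/
def IsZsigmondyBound (q d : ℕ) : Prop :=
  ∀ n, 0 < n → ¬ n ∣ d → ∃ r, IsPrimitivePrime q n r

theorem isZsigmondyBound_two : IsZsigmondyBound 2 6 :=
  fun _ => exists_isPrimitivePrime_two

theorem isZsigmondyBound_of_three_le {q : ℕ} (hq : 3 ≤ q) : IsZsigmondyBound q 2 := by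
  refine fun n hn hn2 => exists_isPrimitivePrime_of_three_le hq ?_
  by_contra!
  interval_cases n <;> simp at hn2

end PrimitivePrimes

section Counting

open Finset

theorem sum_comp_eq_sum_card_mul {α : Type*} [Fintype α] (a : α → ℕ) (f : ℕ → ℕ) {s : Finset ℕ}
    (hs : ∀ i, a i ∈ s) : ∑ i, f (a i) = ∑ k ∈ s, #{i | a i = k} * f k := by
  rw [← sum_fiberwise_of_maps_to fun i _ => hs i]
  refine sum_congr rfl fun k _ => ?_
  rw [← smul_eq_mul, ← sum_const]
  exact sum_congr rfl fun i hi => by rw [(mem_filter.1 hi).2]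

theorem factorization_prod_pow_sub_one {α : Type*} [Fintype α] {q : ℕ} (hq : 1 < q) {a : α → ℕ}
    (ha : ∀ i, 0 < a i) (r : ℕ) :
    (∏ i, (q ^ a i - 1)).factorization r = ∑ i, (q ^ a i - 1).factorization r :=
  Nat.factorization_prod_apply fun i _ =>
    Nat.sub_ne_zero_of_lt (Nat.one_lt_pow (ha i).ne' hq)

section

variable {α β : Type*} [Fintype α] [Fintype β] {a : α → ℕ} {b : β → ℕ} {q d : ℕ}

theorem sum_card_mul_factorization_eq (hq : 1 < q) (ha : ∀ i, 0 < a i) (hb : ∀ j, 0 < b j)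
    (h : ∏ i, (q ^ a i - 1) = ∏ j, (q ^ b j - 1)) {s : Finset ℕ} (has : ∀ i, a i ∈ s)
    (hbs : ∀ j, b j ∈ s) (r : ℕ) :
    ∑ k ∈ s, #{i | a i = k} * (q ^ k - 1).factorization r =
      ∑ k ∈ s, #{j | b j = k} * (q ^ k - 1).factorization r := by
  rw [← sum_comp_eq_sum_card_mul a (fun k => (q ^ k - 1).factorization r) has,
    ← sum_comp_eq_sum_card_mul b (fun k => (q ^ k - 1).factorization r) hbs,
    ← factorization_prod_pow_sub_one hq ha, h, factorization_prod_pow_sub_one hq hb]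

/-- A primitive prime of `q ^ n - 1` divides `q ^ k - 1` only if `n ∣ k`, so its exponents on the
two sides give the claim for `n` from the claim for the proper multiples of `n`. -/
theorem card_filter_eq_of_prod_pow_sub_one_eq (hq : 1 < q) (hqd : IsZsigmondyBound q d)
    (ha : ∀ i, 0 < a i) (hb : ∀ j, 0 < b j) (h : ∏ i, (q ^ a i - 1) = ∏ j, (q ^ b j - 1)) {n : ℕ}
    (hn : ¬ n ∣ d) : #{i | a i = n} = #{j | b j = n} := by
  set s := univ.image a ∪ univ.image b with hs
  have has : ∀ i, a i ∈ s := fun i => mem_union_left _ (mem_image_of_mem a (mem_univ i))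
  have hbs : ∀ j, b j ∈ s := fun j => mem_union_right _ (mem_image_of_mem b (mem_univ j))
  have hspos : ∀ k ∈ s, 0 < k := by
    simp only [hs, mem_union, mem_image, mem_univ, true_and]
    rintro k (⟨i, rfl⟩ | ⟨j, rfl⟩)
    exacts [ha i, hb j]
  induction hm : s.sup id - n using Nat.strong_induction_on generalizing n with
  | _ m ih =>
    by_cases hns : n ∈ s
    swap
    · rw [filter_false_of_mem fun i _ (hi : a i = n) => hns (hi ▸ has i),
        filter_false_of_mem fun j _ (hj : b j = n) => hns (hj ▸ hbs j), card_empty, card_empty]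
    obtain ⟨r, hr⟩ := hqd n (hspos n hns) hn
    have hsum := sum_card_mul_factorization_eq hq ha hb h has hbs r
    have hrest : ∑ k ∈ s.erase n, #{i | a i = k} * (q ^ k - 1).factorization r =
        ∑ k ∈ s.erase n, #{j | b j = k} * (q ^ k - 1).factorization r := by
      refine sum_congr rfl fun k hk => ?_
      obtain ⟨hkn, hks⟩ := mem_erase.1 hk
      by_cases hnk : n ∣ k
      · have hlt : n < k := lt_of_le_of_ne (Nat.le_of_dvd (hspos k hks) hnk) hkn.symm
        have hle : k ≤ s.sup id := le_sup (f := id) hks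
        rw [ih _ (by omega) (fun hkd => hn (hnk.trans hkd)) rfl]
      · rw [Nat.factorization_eq_zero_of_not_dvd (mt (hr.dvd_pow_sub_one_iff k).1 hnk), mul_zero,
          mul_zero]
    rw [← add_sum_erase s _ hns, ← add_sum_erase s _ hns, hrest] at hsum
    have hfpos : 0 < (q ^ n - 1).factorization r :=
      hr.prime.factorization_pos_of_dvd
        (Nat.sub_ne_zero_of_lt (Nat.one_lt_pow (hspos n hns).ne' hq))
        ((hr.dvd_pow_sub_one_iff n).2 dvd_rfl)
    exact Nat.eq_of_mul_eq_mul_right hfpos (Nat.add_right_cancel hsum)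

theorem sum_divisors_card_mul_factorization_eq (hq : 1 < q) (hqd : IsZsigmondyBound q d)
    (hd : d ≠ 0) (ha : ∀ i, 0 < a i) (hb : ∀ j, 0 < b j)
    (h : ∏ i, (q ^ a i - 1) = ∏ j, (q ^ b j - 1)) (r : ℕ) :
    ∑ k ∈ d.divisors, #{i | a i = k} * (q ^ k - 1).factorization r =
      ∑ k ∈ d.divisors, #{j | b j = k} * (q ^ k - 1).factorization r := by
  set s := univ.image a ∪ univ.image b ∪ d.divisors with hs
  have hsum := sum_card_mul_factorization_eq hq ha hb h (s := s) (by simp [hs]) (by simp [hs]) r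
  have hdvd : d.divisors ⊆ s := subset_union_right
  have hrest : ∑ k ∈ s \ d.divisors, #{i | a i = k} * (q ^ k - 1).factorization r =
      ∑ k ∈ s \ d.divisors, #{j | b j = k} * (q ^ k - 1).factorization r := by
    refine sum_congr rfl fun k hk => ?_
    have hkd : ¬ k ∣ d := fun hkd => (mem_sdiff.1 hk).2 (Nat.mem_divisors.2 ⟨hkd, hd⟩)
    rw [card_filter_eq_of_prod_pow_sub_one_eq hq hqd ha hb h hkd]
  rw [← sum_sdiff hdvd, ← sum_sdiff hdvd, hrest] at hsum
  exact Nat.add_left_cancel hsum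

end

theorem card_filter_sum_eq {α β : Type*} [Fintype α] [Fintype β] (p : α ⊕ β → Prop)
    [DecidablePred p] : #{x | p x} = #{i | p (.inl i)} + #{j | p (.inr j)} := by
  simp only [card_filter, Fintype.sum_sum_type]

theorem card_filter_sumElim_eq {α β : Type*} [Fintype α] [Fintype β] (a : α → ℕ) (b : β → ℕ)
    (k : ℕ) : #{x | Sum.elim a b x = k} = #{i | a i = k} + #{j | b j = k} :=
  card_filter_sum_eq _

end Counting

section Multiplicative

open Polynomial

variable {K : Type*} [Field K]

theorem isCoprime_of_monic_irreducible {P Q : K[X]} (hP : P.Monic) (hQ : Q.Monic)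
    (hP' : Irreducible P) (hQ' : Irreducible Q) (h : P ≠ Q) : IsCoprime P Q :=
  (hP'.coprime_iff_not_dvd).2 fun hd =>
    h (eq_of_monic_of_associated hP hQ (hP'.associated_of_dvd hQ' hd))

theorem finite_setOf_natDegree_le [Finite K] (n : ℕ) : {A : K[X] | A.natDegree ≤ n}.Finite := by
  have : Finite (degreeLT K (n + 1)) := Finite.of_equiv _ (degreeLTEquiv K (n + 1)).symm.toEquiv
  refine (Set.toFinite (degreeLT K (n + 1) : Set K[X])).subset fun A hA => ?_
  rw [SetLike.mem_coe, mem_degreeLT]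
  exact lt_of_le_of_lt degree_le_natDegree (by exact_mod_cast Nat.lt_succ_of_le hA)

theorem finite_monic_divisors [Finite K] {G : K[X]} (hG : G ≠ 0) :
    {D : K[X] | D.Monic ∧ D ∣ G}.Finite :=
  (finite_setOf_natDegree_le G.natDegree).subset fun _ hD => natDegree_le_of_dvd hD.2 hG

theorem norm_mul {A B : K[X]} (hA : A ≠ 0) (hB : B ≠ 0) :
    norm K (A * B) = norm K A * norm K B := by
  rw [norm, natDegree_mul hA hB, pow_add, norm, norm]

theorem sigma_eq_of_associated {A B : K[X]} (h : Associated A B) : sigma K A = sigma K B := by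
  simp only [sigma, h.dvd_iff_dvd_right]

theorem monic_divisors_mul {A B : K[X]} (hA : A ≠ 0) (hB : B ≠ 0) :
    {D : K[X] | D.Monic ∧ D ∣ A * B} = (fun p : K[X] × K[X] => p.1 * p.2) ''
      ({D : K[X] | D.Monic ∧ D ∣ A} ×ˢ {D : K[X] | D.Monic ∧ D ∣ B}) := by
  classical
  ext D
  constructor
  · rintro ⟨hD, hdvd⟩
    obtain ⟨a, b, ha, hb, rfl⟩ := exists_dvd_and_dvd_of_dvd_mul hdvd
    refine ⟨(normalize a, normalize b),
      ⟨⟨monic_normalize (ne_zero_of_dvd_ne_zero hA ha), normalize_dvd_iff.2 ha⟩,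
        monic_normalize (ne_zero_of_dvd_ne_zero hB hb), normalize_dvd_iff.2 hb⟩, ?_⟩
    exact (normalize_mul a b).symm.trans hD.normalize_eq_self
  · rintro ⟨⟨a, b⟩, ⟨⟨ha, hadvd⟩, hb, hbdvd⟩, rfl⟩
    exact ⟨ha.mul hb, mul_dvd_mul hadvd hbdvd⟩

theorem injOn_mul_monic_divisors {A B : K[X]} (h : IsCoprime A B) :
    Set.InjOn (fun p : K[X] × K[X] => p.1 * p.2)
      ({D : K[X] | D.Monic ∧ D ∣ A} ×ˢ {D : K[X] | D.Monic ∧ D ∣ B}) := by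
  rintro ⟨a, b⟩ ⟨⟨ha, haA⟩, -, hbB⟩ ⟨c, d⟩ ⟨⟨hc, hcA⟩, -, hdB⟩ (heq : a * b = c * d)
  obtain rfl : a = c := by
    refine eq_of_monic_of_associated ha hc (associated_of_dvd_dvd ?_ ?_)
    · exact ((h.of_isCoprime_of_dvd_left haA).of_isCoprime_of_dvd_right hdB).dvd_of_dvd_mul_right
        (heq ▸ dvd_mul_right a b)
    · exact ((h.of_isCoprime_of_dvd_left hcA).of_isCoprime_of_dvd_right hbB).dvd_of_dvd_mul_right
        (heq.symm ▸ dvd_mul_right c d)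
  exact Prod.ext rfl (mul_left_cancel₀ ha.ne_zero heq)

theorem sigma_mul [Finite K] {A B : K[X]} (hA : A ≠ 0) (hB : B ≠ 0) (h : IsCoprime A B) :
    sigma K (A * B) = sigma K A * sigma K B := by
  have hfA := finite_monic_divisors hA
  have hfB := finite_monic_divisors hB
  rw [sigma, monic_divisors_mul hA hB, finsum_mem_image (injOn_mul_monic_divisors h),
    finsum_mem_eq_finite_toFinset_sum _ (hfA.prod hfB), ← Set.Finite.toFinset_prod hfA hfB,
    Finset.sum_product, sigma, sigma, finsum_mem_eq_finite_toFinset_sum _ hfA,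
    finsum_mem_eq_finite_toFinset_sum _ hfB, Finset.sum_mul_sum]
  refine Finset.sum_congr rfl fun a ha => Finset.sum_congr rfl fun b hb => ?_
  rw [Set.Finite.mem_toFinset] at ha hb
  exact norm_mul ha.1.ne_zero hb.1.ne_zero

theorem sigma_pow {P : K[X]} (hP : P.Monic) (hirr : Irreducible P) (e : ℕ) :
    sigma K (P ^ e) = ∑ i ∈ Finset.range (e + 1), (Nat.card K ^ P.natDegree) ^ i := by
  have himg : {D : K[X] | D.Monic ∧ D ∣ P ^ e} = (P ^ ·) '' (Finset.range (e + 1) : Set ℕ) := by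
    ext D
    simp only [Set.mem_ofPred_eq, Set.mem_image, Finset.coe_range, Set.mem_Iio]
    constructor
    · rintro ⟨hD, hdvd⟩
      obtain ⟨i, hi, hass⟩ := (dvd_prime_pow hirr.prime e).1 hdvd
      exact ⟨i, by omega, (eq_of_monic_of_associated hD (hP.pow i) hass).symm⟩
    · rintro ⟨i, hi, rfl⟩
      exact ⟨hP.pow i, pow_dvd_pow P (by omega)⟩
  have hinj : Set.InjOn (P ^ ·) (Finset.range (e + 1) : Set ℕ) := by
    intro i _ j _ hij
    have hdeg := congrArg natDegree hij
    simp only [natDegree_pow] at hdeg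
    exact Nat.eq_of_mul_eq_mul_right hirr.natDegree_pos hdeg
  rw [sigma, himg, finsum_mem_image hinj, finsum_mem_coe_finset]
  refine Finset.sum_congr rfl fun i _ => ?_
  rw [norm, natDegree_pow, mul_comm, pow_mul]

theorem pow_sub_one_mul_sigma_pow [Finite K] {P : K[X]} (hP : P.Monic) (hirr : Irreducible P)
    (e : ℕ) : (Nat.card K ^ P.natDegree - 1) * sigma K (P ^ e) =
      Nat.card K ^ ((e + 1) * P.natDegree) - 1 := by
  rw [sigma_pow hP hirr, mul_comm (e + 1), pow_mul]
  have hone : 1 ≤ Nat.card K ^ P.natDegree := Nat.one_le_pow _ _ Nat.card_pos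
  zify [hone, Nat.one_le_pow (e + 1) _ hone]
  exact mul_geom_sum _ _

theorem sigma_one : sigma K (1 : K[X]) = 1 := by
  have hdiv : {D : K[X] | D.Monic ∧ D ∣ 1} = {1} := by
    ext D
    constructor
    · rintro ⟨hD, hdvd⟩
      exact hD.eq_one_of_isUnit (isUnit_of_dvd_one hdvd)
    · rintro rfl
      exact ⟨monic_one, dvd_rfl⟩
  rw [sigma, hdiv, finsum_mem_singleton, norm, natDegree_one, pow_zero]

theorem sigma_prod [Finite K] {ι : Type*} (s : Finset ι) (f : ι → K[X]) (h0 : ∀ i ∈ s, f i ≠ 0)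
    (hc : (s : Set ι).Pairwise fun i j => IsCoprime (f i) (f j)) :
    sigma K (∏ i ∈ s, f i) = ∏ i ∈ s, sigma K (f i) := by
  classical
  induction s using Finset.induction_on with
  | empty => rw [Finset.prod_empty, Finset.prod_empty, sigma_one]
  | insert a s ha ih =>
    rw [Finset.forall_mem_insert] at h0
    rw [Finset.prod_insert ha, Finset.prod_insert ha, sigma_mul h0.1, ih h0.2]
    · exact hc.mono (by exact_mod_cast Finset.subset_insert a s)
    · exact Finset.prod_ne_zero_iff.2 h0.2
    · exact IsCoprime.prod_right fun i hi =>
        hc (by simp) (by simp [hi]) (by rintro rfl; exact ha hi)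

theorem phi_eq_of_associated {A B : K[X]} (h : Associated A B) : phi K A = phi K B := by
  rw [phi, phi, Ideal.span_singleton_eq_span_singleton.2 h]

theorem phi_mul {A B : K[X]} (h : IsCoprime A B) : phi K (A * B) = phi K A * phi K B := by
  have hc : IsCoprime (Ideal.span {A}) (Ideal.span {B}) := by
    rwa [Ideal.isCoprime_span_singleton_iff]
  rw [phi, phi, phi, ← Ideal.span_singleton_mul_span_singleton, ← Nat.card_prod]
  exact Nat.card_congr ((Units.mapEquiv
    (Ideal.quotientMulEquivQuotientProd _ _ hc).toMulEquiv).trans MulEquiv.prodUnits).toEquiv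

theorem phi_one : phi K (1 : K[X]) = 1 := by
  have : Subsingleton (K[X] ⧸ Ideal.span {(1 : K[X])}) :=
    Ideal.Quotient.subsingleton_iff.2 Ideal.span_singleton_one
  rw [phi, Nat.card_unique]

theorem phi_prod {ι : Type*} (s : Finset ι) (f : ι → K[X])
    (hc : (s : Set ι).Pairwise fun i j => IsCoprime (f i) (f j)) :
    phi K (∏ i ∈ s, f i) = ∏ i ∈ s, phi K (f i) := by
  classical
  induction s using Finset.induction_on with
  | empty => rw [Finset.prod_empty, Finset.prod_empty, phi_one]
  | insert a s ha ih =>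
    rw [Finset.prod_insert ha, Finset.prod_insert ha, phi_mul, ih]
    · exact hc.mono (by exact_mod_cast Finset.subset_insert a s)
    · exact IsCoprime.prod_right fun i hi =>
        hc (by simp) (by simp [hi]) (by rintro rfl; exact ha hi)

theorem phi_irreducible [Finite K] {P : K[X]} (hP : Irreducible P) :
    phi K P = Nat.card K ^ P.natDegree - 1 := by
  have : (Ideal.span {P}).IsMaximal := PrincipalIdealRing.isMaximal_of_irreducible hP
  let _ := Ideal.Quotient.field (Ideal.span {P})
  have : Module.Finite K (K[X] ⧸ Ideal.span {P}) := (AdjoinRoot.powerBasis hP.ne_zero).finite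
  rw [phi, Nat.card_units, Module.natCard_eq_pow_finrank (K := K),
    finrank_quotient_span_eq_natDegree]

theorem dvd_card_units_of_sq_eq_zero {R : Type*} [CommRing R] {p : ℕ} [CharP R p] (hp : p.Prime)
    {x : R} (hx : x ≠ 0) (hx2 : x ^ 2 = 0) : p ∣ Nat.card Rˣ := by
  have := Fact.mk hp
  have hpow : (1 + x) ^ p = 1 := by
    rw [add_pow_char, one_pow, ← Nat.sub_add_cancel hp.two_le, pow_add, hx2, mul_zero, add_zero]
  have horder : orderOf (Units.ofPowEqOne (1 + x) p hpow hp.ne_zero) = p := by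
    refine orderOf_eq_prime (Units.pow_ofPowEqOne hpow hp.ne_zero) fun hone => hx ?_
    simpa using congrArg Units.val hone
  exact horder ▸ orderOf_dvd_natCard _

theorem ringChar_prime [Finite K] : (ringChar K).Prime := CharP.char_is_prime K (ringChar K)

theorem ringChar_dvd_card [Finite K] : ringChar K ∣ Nat.card K := by
  have := Fintype.ofFinite K
  rw [Nat.card_eq_fintype_card]
  exact ringChar.dvd (Nat.cast_card_eq_zero K)

theorem ringChar_dvd_phi_of_sq_dvd [Finite K] {F P : K[X]} (hF : F ≠ 0) (hP : Irreducible P)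
    (h : P ^ 2 ∣ F) : ringChar K ∣ phi K F := by
  obtain ⟨H, rfl⟩ := h
  have hPH : P * H ≠ 0 := by
    intro h0
    exact hF (by rw [pow_two, mul_assoc, h0, mul_zero])
  have hx : Ideal.Quotient.mk (Ideal.span {P ^ 2 * H}) (P * H) ≠ 0 := by
    rw [Ne, Ideal.Quotient.eq_zero_iff_mem, Ideal.mem_span_singleton, pow_two, mul_assoc]
    intro hd
    have hP1 : P ∣ 1 := (mul_dvd_mul_iff_right hPH).1 (by rwa [one_mul])
    exact hP.not_isUnit (isUnit_of_dvd_one hP1)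
  have hx2 : Ideal.Quotient.mk (Ideal.span {P ^ 2 * H}) (P * H) ^ 2 = 0 := by
    rw [← map_pow, Ideal.Quotient.eq_zero_iff_mem, Ideal.mem_span_singleton]
    exact ⟨H, by ring⟩
  have : Nontrivial (K[X] ⧸ Ideal.span {P ^ 2 * H}) := ⟨_, 0, hx⟩
  have := charP_of_injective_algebraMap
    (algebraMap K (K[X] ⧸ Ideal.span {P ^ 2 * H})).injective (ringChar K)
  exact dvd_card_units_of_sq_eq_zero ringChar_prime hx hx2

end Multiplicative

section Factorizations

open Polynomial UniqueFactorizationMonoid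

variable {K : Type*} [Field K]

/-- `G` is a constant times `∏ i, P i ^ e i` for distinct monic primes `P i` and exponents
`e i > 0`. -/
structure IsFactorization {ι : Type*} [Fintype ι] (G : K[X]) (P : ι → K[X]) (e : ι → ℕ) :
    Prop where
  monic : ∀ i, (P i).Monic
  irreducible : ∀ i, Irreducible (P i)
  injective : Function.Injective P
  pos : ∀ i, 0 < e i
  associated : Associated G (∏ i, P i ^ e i)

theorem exists_isFactorization {G : K[X]} (hG : G ≠ 0) :
    ∃ (n : ℕ) (P : Fin n → K[X]) (e : Fin n → ℕ), IsFactorization G P e := by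
  classical
  set S := (normalizedFactors G).toFinset with hS
  have hmem (i) : (S.equivFin.symm i : K[X]) ∈ normalizedFactors G :=
    Multiset.mem_toFinset.1 (S.equivFin.symm i).2
  refine ⟨S.card, fun i => S.equivFin.symm i, fun i => (normalizedFactors G).count
    (S.equivFin.symm i : K[X]), fun i => ?_, fun i => irreducible_of_normalized_factor _ (hmem i),
    Subtype.val_injective.comp S.equivFin.symm.injective,
    fun i => Multiset.count_pos.2 (hmem i), ?_⟩
  · rw [← normalize_normalized_factor _ (hmem i)]
    exact monic_normalize (irreducible_of_normalized_factor _ (hmem i)).ne_zero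
  · rw [S.equivFin.symm.prod_comp fun P : S => (P : K[X]) ^ (normalizedFactors G).count (P : K[X]),
      Finset.prod_coe_sort S fun P => P ^ (normalizedFactors G).count P, hS,
      ← Finset.prod_multiset_count]
    exact (prod_normalizedFactors hG).symm

namespace IsFactorization

variable {ι : Type*} [Fintype ι] {G : K[X]} {P : ι → K[X]} {e : ι → ℕ}

theorem ne_zero (h : IsFactorization G P e) : G ≠ 0 := by
  rw [Ne, h.associated.eq_zero_iff]
  exact Finset.prod_ne_zero_iff.2 fun i _ => pow_ne_zero _ (h.irreducible i).ne_zero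

theorem natDegree_pos (h : IsFactorization G P e) (i : ι) : 0 < (P i).natDegree :=
  (h.irreducible i).natDegree_pos

theorem two_mul_natDegree_le (h : IsFactorization G P e) (i : ι) :
    2 * (P i).natDegree ≤ (e i + 1) * (P i).natDegree :=
  Nat.mul_le_mul_right _ (Nat.succ_le_succ (h.pos i))

theorem isCoprime (h : IsFactorization G P e) {i j : ι} (hij : i ≠ j) : IsCoprime (P i) (P j) :=
  isCoprime_of_monic_irreducible (h.monic i) (h.monic j) (h.irreducible i) (h.irreducible j)
    (h.injective.ne hij)

theorem pow_dvd (h : IsFactorization G P e) (i : ι) : P i ^ e i ∣ G :=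
  (Finset.dvd_prod_of_mem (fun i => P i ^ e i) (Finset.mem_univ i)).trans h.associated.symm.dvd

theorem not_pow_succ_dvd (h : IsFactorization G P e) (i : ι) : ¬ P i ^ (e i + 1) ∣ G := by
  classical
  intro hd
  replace hd := hd.trans h.associated.dvd
  rw [← Finset.mul_prod_erase _ _ (Finset.mem_univ i), pow_succ] at hd
  have hdvd := (mul_dvd_mul_iff_left (pow_ne_zero _ (h.irreducible i).ne_zero)).1 hd
  have hc : IsCoprime (P i) (∏ j ∈ Finset.univ.erase i, P j ^ e j) :=
    IsCoprime.prod_right fun j hj => (h.isCoprime (Finset.ne_of_mem_erase hj).symm).pow_right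
  exact (h.irreducible i).not_isUnit (hc.isUnit_of_dvd' dvd_rfl hdvd)

theorem exists_associated_of_dvd (h : IsFactorization G P e) {Q : K[X]} (hQ : Irreducible Q)
    (hd : Q ∣ G) : ∃ i, Associated Q (P i) := by
  obtain ⟨i, -, hi⟩ := hQ.prime.exists_mem_finset_dvd (hd.trans h.associated.dvd)
  exact ⟨i, hQ.associated_of_dvd (h.irreducible i) (hQ.prime.dvd_of_dvd_pow hi)⟩

variable [Finite K]

theorem sigma_eq (h : IsFactorization G P e) : sigma K G = ∏ i, sigma K (P i ^ e i) := by
  rw [sigma_eq_of_associated h.associated, sigma_prod]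
  · exact fun i _ => pow_ne_zero _ (h.irreducible i).ne_zero
  · exact fun i _ j _ hij => (h.isCoprime hij).pow

theorem prod_mul_sigma_eq (h : IsFactorization G P e) :
    (∏ i, (Nat.card K ^ (P i).natDegree - 1)) * sigma K G =
      ∏ i, (Nat.card K ^ ((e i + 1) * (P i).natDegree) - 1) := by
  rw [h.sigma_eq, ← Finset.prod_mul_distrib]
  exact Finset.prod_congr rfl fun i _ =>
    pow_sub_one_mul_sigma_pow (h.monic i) (h.irreducible i) _

theorem phi_eq (h : IsFactorization G P e) (he : ∀ i, e i = 1) :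
    phi K G = ∏ i, (Nat.card K ^ (P i).natDegree - 1) := by
  rw [phi_eq_of_associated h.associated, phi_prod _ _ fun i _ j _ hij => (h.isCoprime hij).pow]
  exact Finset.prod_congr rfl fun i _ => by rw [he i, pow_one, phi_irreducible (h.irreducible i)]

theorem exponent_eq_one (h : IsFactorization G P e) (hphi : ¬ ringChar K ∣ phi K G) (i : ι) :
    e i = 1 := by
  have hpos := h.pos i
  by_contra hne
  exact hphi (ringChar_dvd_phi_of_sq_dvd h.ne_zero (h.irreducible i)
    ((pow_dvd_pow _ (by omega)).trans (h.pow_dvd i)))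

end IsFactorization

theorem not_ringChar_dvd_sigma [Finite K] {G : K[X]} (hG : G ≠ 0) :
    ¬ ringChar K ∣ sigma K G := by
  obtain ⟨n, P, e, h⟩ := exists_isFactorization hG
  intro hd
  rw [h.sigma_eq] at hd
  obtain ⟨i, -, hd⟩ := (Prime.dvd_finsetProd_iff ringChar_prime.prime _).1 hd
  rw [sigma_pow (h.monic i) (h.irreducible i), Finset.sum_range_succ', pow_zero,
    ← Nat.dvd_add_iff_right] at hd
  · exact ringChar_prime.one_lt.ne' (Nat.dvd_one.1 hd)
  · refine Finset.dvd_sum fun j _ => dvd_pow ?_ (Nat.succ_ne_zero j)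
    exact ringChar_dvd_card.trans (dvd_pow_self _ (h.irreducible i).natDegree_pos.ne')

theorem sigma_pos [Finite K] {G : K[X]} (hG : G ≠ 0) : 0 < sigma K G :=
  Nat.pos_of_ne_zero fun h0 => not_ringChar_dvd_sigma hG (h0 ▸ dvd_zero _)

section

variable [Finite K] {ι κ : Type*} [Fintype ι] [Fintype κ] {F G : K[X]} {P : ι → K[X]} {f : ι → ℕ}
  {Q : κ → K[X]} {e : κ → ℕ} {N : ℕ}

theorem exponent_eq_one_of_phi_mul_eq_sigma (hF : IsFactorization F P f) (hG : G ≠ 0)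
    (h : phi K F * N = sigma K G) (i : ι) : f i = 1 :=
  hF.exponent_eq_one (fun hd => not_ringChar_dvd_sigma hG (h ▸ hd.mul_right N)) i

theorem prod_pow_sub_one_eq_of_phi_mul_eq_sigma (hF : IsFactorization F P f)
    (hG : IsFactorization G Q e) (h : phi K F * N = sigma K G) :
    (∏ i, (Nat.card K ^ (P i).natDegree - 1)) * (∏ j, (Nat.card K ^ (Q j).natDegree - 1)) * N =
      ∏ j, (Nat.card K ^ ((e j + 1) * (Q j).natDegree) - 1) := by
  rw [← hG.prod_mul_sigma_eq, ← h,
    hF.phi_eq (exponent_eq_one_of_phi_mul_eq_sigma hF hG.ne_zero h)]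
  ring

end

end Factorizations

section Chains

open Polynomial

namespace ExpTuple

theorem deg_one (v : ExpTuple) : v.deg 1 = v.val 0 := by
  rw [deg, Finset.Ico_self, Finset.prod_empty, mul_one]

theorem deg_succ (v : ExpTuple) {k : ℕ} (hk : 1 ≤ k) :
    v.deg (k + 1) = (v.val k + 1) * v.deg k := by
  rw [deg, Finset.prod_Ico_succ_top hk, deg]
  ring

theorem deg_pos (v : ExpTuple) (k : ℕ) : 0 < v.deg k :=
  Nat.mul_pos (v.val_pos 0 (Nat.zero_le _)) (Finset.prod_pos fun _ _ => Nat.succ_pos _)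

theorem strictMonoOn_deg (v : ExpTuple) : StrictMonoOn v.deg (Set.Icc 1 (v.len + 1)) := by
  refine strictMonoOn_of_lt_add_one Set.ordConnected_Icc fun k _ hk hk' => ?_
  rw [v.deg_succ hk.1]
  have hval := v.val_pos k (Nat.le_of_succ_le_succ hk'.2)
  exact lt_mul_of_one_lt_left (v.deg_pos k) (by omega)

theorem injOn_deg (v : ExpTuple) : Set.InjOn v.deg (Finset.Icc 1 (v.len + 1) : Set ℕ) := by
  rw [Finset.coe_Icc]
  exact v.strictMonoOn_deg.injOn

theorem dvd_deg (v : ExpTuple) (k : ℕ) : v.val 0 ∣ v.deg k := dvd_mul_right _ _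

end ExpTuple

variable {K : Type*} [Field K]

/-- The values `P 1, …, P (len + 1)` are monic primes of the degrees prescribed by `v`, so that
they define a pair in `chainSet K v`. -/
structure IsPrimeChain (v : ExpTuple) (P : ℕ → K[X]) : Prop where
  monic : ∀ k ∈ Finset.Icc 1 (v.len + 1), (P k).Monic
  irreducible : ∀ k ∈ Finset.Icc 1 (v.len + 1), Irreducible (P k)
  natDegree_eq : ∀ k ∈ Finset.Icc 1 (v.len + 1), (P k).natDegree = v.deg k

theorem mem_chainSet_iff {v : ExpTuple} {A B : K[X]} :
    (A, B) ∈ chainSet K v ↔ ∃ P : ℕ → K[X], IsPrimeChain v P ∧ A = P (v.len + 1) ∧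
      B = ∏ k ∈ Finset.Icc 1 v.len, P k ^ v.val k :=
  exists_congr fun _ => and_congr_left fun _ =>
    ⟨fun h => ⟨fun k hk => (h k hk).1, fun k hk => (h k hk).2.1, fun k hk => (h k hk).2.2⟩,
      fun h k hk => ⟨h.monic k hk, h.irreducible k hk, h.natDegree_eq k hk⟩⟩

theorem mem_Icc_len_succ {v : ExpTuple} {k : ℕ} (hk : k ∈ Finset.Icc 1 v.len) :
    k ∈ Finset.Icc 1 (v.len + 1) :=
  Finset.Icc_subset_Icc_right (Nat.le_succ _) hk

namespace IsPrimeChain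

variable {v : ExpTuple} {P : ℕ → K[X]}

theorem ne_zero (h : IsPrimeChain v P) {k : ℕ} (hk : k ∈ Finset.Icc 1 (v.len + 1)) : P k ≠ 0 :=
  (h.irreducible k hk).ne_zero

theorem prod_ne_zero (h : IsPrimeChain v P) : ∏ k ∈ Finset.Icc 1 v.len, P k ^ v.val k ≠ 0 :=
  Finset.prod_ne_zero_iff.2 fun _ hk => pow_ne_zero _ (h.ne_zero (mem_Icc_len_succ hk))

theorem isCoprime (h : IsPrimeChain v P) {j k : ℕ} (hj : j ∈ Finset.Icc 1 (v.len + 1))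
    (hk : k ∈ Finset.Icc 1 (v.len + 1)) (hjk : j ≠ k) : IsCoprime (P j) (P k) := by
  refine isCoprime_of_monic_irreducible (h.monic j hj) (h.monic k hk) (h.irreducible j hj)
    (h.irreducible k hk) fun heq => hjk (v.injOn_deg hj hk ?_)
  rw [← h.natDegree_eq j hj, ← h.natDegree_eq k hk, heq]

/-- The product telescopes because `deg (k + 1) = (v_k + 1) * deg k`. -/
theorem pow_sub_one_mul_prod_sigma [Finite K] (h : IsPrimeChain v P) {n : ℕ} (hn : n ≤ v.len) :
    (Nat.card K ^ v.val 0 - 1) * ∏ k ∈ Finset.Icc 1 n, sigma K (P k ^ v.val k) =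
      Nat.card K ^ v.deg (n + 1) - 1 := by
  induction n with
  | zero =>
    rw [Finset.Icc_eq_empty_of_lt zero_lt_one, Finset.prod_empty, mul_one, zero_add, v.deg_one]
  | succ n ih =>
    have hmem : n + 1 ∈ Finset.Icc 1 (v.len + 1) := by
      rw [Finset.mem_Icc]
      omega
    rw [Finset.prod_Icc_succ_top (by omega), ← mul_assoc, ih (by omega),
      ← h.natDegree_eq _ hmem, pow_sub_one_mul_sigma_pow (h.monic _ hmem) (h.irreducible _ hmem),
      h.natDegree_eq _ hmem, ← v.deg_succ (by omega)]

end IsPrimeChain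

theorem pow_sub_one_mul_sigma_eq_phi [Finite K] {v : ExpTuple} {A B : K[X]}
    (h : (A, B) ∈ chainSet K v) : (Nat.card K ^ v.val 0 - 1) * sigma K B = phi K A := by
  obtain ⟨P, hP, rfl, rfl⟩ := mem_chainSet_iff.1 h
  have hlast : v.len + 1 ∈ Finset.Icc 1 (v.len + 1) := Finset.right_mem_Icc.2 (by omega)
  rw [phi_irreducible (hP.irreducible _ hlast), hP.natDegree_eq _ hlast,
    ← hP.pow_sub_one_mul_prod_sigma le_rfl, sigma_prod]
  · exact fun j hj => pow_ne_zero _ (hP.ne_zero (mem_Icc_len_succ hj))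
  · exact fun j hj k hk hjk =>
      (hP.isCoprime (mem_Icc_len_succ hj) (mem_Icc_len_succ hk) hjk).pow

theorem IsDecomposition.phi_eq_sigma_iff [Finite K] {d n : ℕ} {F G : K[X]}
    {v : Fin n → ExpTuple} {A B : Fin (n + 1) → K[X]} (h : IsDecomposition d F G v A B)
    (hB : B 0 ≠ 0) :
    phi K F = sigma K G ↔
      phi K (A 0) * ∏ i, (Nat.card K ^ (v i).val 0 - 1) = sigma K (B 0) := by
  have hne : ∀ i, B i ≠ 0 := Fin.cases hB fun i => by
    obtain ⟨P, hP, -, hB⟩ := mem_chainSet_iff.1 (h.mem_chainSet i)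
    exact hB ▸ hP.prod_ne_zero
  have hphi : phi K F = phi K (A 0) * (∏ i, (Nat.card K ^ (v i).val 0 - 1)) *
      ∏ i : Fin n, sigma K (B i.succ) := by
    rw [h.prod_left, phi_prod _ _ fun i _ j _ => h.coprime_left i j, Fin.prod_univ_succ, mul_assoc,
      ← Finset.prod_mul_distrib]
    congr 1
    exact Finset.prod_congr rfl fun i _ => (pow_sub_one_mul_sigma_eq_phi (h.mem_chainSet i)).symm
  have hsigma : sigma K G = sigma K (B 0) * ∏ i : Fin n, sigma K (B i.succ) := by
    rw [h.prod_right, sigma_prod _ _ (fun i _ => hne i) fun i _ j _ => h.coprime_right i j,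
      Fin.prod_univ_succ]
  rw [hphi, hsigma]
  exact Nat.mul_left_inj (Finset.prod_ne_zero_iff.2 fun i _ => (sigma_pos (hne _)).ne')

theorem isCoprime_cons {R : Type*} [CommRing R] {n : ℕ} {a : R} {f : Fin n → R}
    (h0 : ∀ i, IsCoprime (f i) a) (hf : ∀ i j, i ≠ j → IsCoprime (f i) (f j))
    (i j : Fin (n + 1)) (hij : i ≠ j) :
    IsCoprime (Fin.cons (α := fun _ => R) a f i) (Fin.cons (α := fun _ => R) a f j) := by
  cases i using Fin.cases <;> cases j using Fin.cases
  · exact absurd rfl hij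
  · exact (h0 _).symm
  · exact h0 _
  · exact hf _ _ (mt (congrArg Fin.succ) hij)

/-- A prime may occur at the end of one chain and inside another, since `F` and `G` need not be
coprime: only the ends, and separately the inner primes, have to be distinct. -/
theorem isDecomposition_cons {d n : ℕ} {v : Fin n → ExpTuple} {P : Fin n → ℕ → K[X]} {F₀ G₀ : K[X]}
    (hv : ∀ i, (v i).val 0 ∣ d) (hP : ∀ i, IsPrimeChain (v i) (P i))
    (hends : ∀ i j, i ≠ j → P i ((v i).len + 1) ≠ P j ((v j).len + 1))
    (hinner : ∀ i j, i ≠ j → ∀ k ∈ Finset.Icc 1 (v i).len, ∀ l ∈ Finset.Icc 1 (v j).len,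
      P i k ≠ P j l)
    (hF : ∀ i, ¬ P i ((v i).len + 1) ∣ F₀) (hG : ∀ i, ∀ k ∈ Finset.Icc 1 (v i).len, ¬ P i k ∣ G₀) :
    IsDecomposition d (F₀ * ∏ i, P i ((v i).len + 1))
      (G₀ * ∏ i, ∏ k ∈ Finset.Icc 1 (v i).len, P i k ^ (v i).val k) v
      (Fin.cons F₀ fun i => P i ((v i).len + 1))
      (Fin.cons G₀ fun i => ∏ k ∈ Finset.Icc 1 (v i).len, P i k ^ (v i).val k) where
  prod_left := (Fin.prod_cons _ _).symm
  prod_right := (Fin.prod_cons _ _).symm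
  coprime_left := by
    have hlast (i) : (v i).len + 1 ∈ Finset.Icc 1 ((v i).len + 1) :=
      Finset.right_mem_Icc.2 (by omega)
    refine isCoprime_cons (fun i => ?_) fun i j hij => ?_
    · exact ((hP i).irreducible _ (hlast i)).coprime_iff_not_dvd.2 (hF i)
    · exact isCoprime_of_monic_irreducible ((hP i).monic _ (hlast i)) ((hP j).monic _ (hlast j))
        ((hP i).irreducible _ (hlast i)) ((hP j).irreducible _ (hlast j)) (hends i j hij)
  coprime_right := by
    refine isCoprime_cons (fun i => IsCoprime.prod_left fun k hk => ?_) fun i j hij =>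
      IsCoprime.prod_left fun k hk => IsCoprime.prod_right fun l hl => ?_
    · have hirr := (hP i).irreducible k (mem_Icc_len_succ hk)
      exact (hirr.coprime_iff_not_dvd.2 (hG i k hk)).pow_left
    · have hk' := mem_Icc_len_succ hk
      have hl' := mem_Icc_len_succ hl
      exact (isCoprime_of_monic_irreducible ((hP i).monic k hk') ((hP j).monic l hl')
        ((hP i).irreducible k hk') ((hP j).irreducible l hl') (hinner i j hij k hk l hl)).pow
  mem_chainSet i := mem_chainSet_iff.2 ⟨P i, hP i, Fin.cons_succ _ _ _, Fin.cons_succ _ _ _⟩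
  dvd := hv

end Chains

section PrimeCount

open Polynomial UniqueFactorizationMonoid

variable {K : Type*} [Field K] [Finite K]

theorem finite_setOf_prime_natDegree_eq (k : ℕ) :
    {P : K[X] | P.Monic ∧ Irreducible P ∧ P.natDegree = k}.Finite :=
  (finite_setOf_natDegree_le k).subset fun _ hP => hP.2.2.le

variable (K) in
/-- The finite set of monic primes of degree `k`. -/
noncomputable def primesOfDegree (k : ℕ) : Finset K[X] :=
  (finite_setOf_prime_natDegree_eq k).toFinset

theorem mem_primesOfDegree {k : ℕ} {P : K[X]} :
    P ∈ primesOfDegree K k ↔ P.Monic ∧ Irreducible P ∧ P.natDegree = k :=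
  Set.Finite.mem_toFinset _

theorem pairwiseDisjoint_primesOfDegree (s : Set ℕ) : s.PairwiseDisjoint (primesOfDegree K) :=
  fun _ _ _ _ hij => Finset.disjoint_left.2 fun _ hP hP' =>
    hij ((mem_primesOfDegree.1 hP).2.2.symm.trans (mem_primesOfDegree.1 hP').2.2)

theorem squarefree_X_pow_card_pow_sub_X {k : ℕ} (hk : k ≠ 0) :
    Squarefree (X ^ Nat.card K ^ k - X : K[X]) := by
  have hdvd : ringChar K ∣ Nat.card K ^ k := ringChar_dvd_card.trans (dvd_pow_self _ hk)
  exact (galois_poly_separable (ringChar K) _ hdvd).squarefree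

theorem prod_primesOfDegree_eq {k : ℕ} (hk : k ≠ 0) :
    ∏ j ∈ k.divisors, ∏ P ∈ primesOfDegree K j, P = X ^ Nat.card K ^ k - X := by
  classical
  set A : K[X] := X ^ Nat.card K ^ k - X
  have hcard : 1 < Nat.card K ^ k := Nat.one_lt_pow hk Finite.one_lt_card
  have hmonic : A.Monic := monic_X_pow_sub (by rw [degree_X]; exact_mod_cast hcard)
  have hnodup := (squarefree_iff_nodup_normalizedFactors hmonic.ne_zero).1
    (squarefree_X_pow_card_pow_sub_X hk)
  have hfactors : k.divisors.biUnion (primesOfDegree K) = (normalizedFactors A).toFinset := by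
    ext P
    simp only [Finset.mem_biUnion, Nat.mem_divisors, mem_primesOfDegree, Multiset.mem_toFinset,
      Polynomial.mem_normalizedFactors_iff hmonic.ne_zero]
    constructor
    · rintro ⟨j, ⟨hj, -⟩, hP, hirr, rfl⟩
      exact ⟨hirr, hP, hirr.natDegree_dvd_iff_dvd_X_pow_card_pow_sub_X.1 hj⟩
    · rintro ⟨hirr, hP, hdvd⟩
      exact ⟨_, ⟨hirr.natDegree_dvd_iff_dvd_X_pow_card_pow_sub_X.2 hdvd, hk⟩, hP, hirr, rfl⟩
  rw [← Finset.prod_biUnion (pairwiseDisjoint_primesOfDegree _), hfactors,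
    Finset.prod_eq_multiset_prod, Multiset.map_id', Multiset.toFinset_val,
    Multiset.dedup_eq_self.2 hnodup, prod_normalizedFactors_eq hmonic.ne_zero,
    hmonic.normalize_eq_self]

theorem sum_divisors_mul_card_primesOfDegree {k : ℕ} (hk : k ≠ 0) :
    ∑ j ∈ k.divisors, j * (primesOfDegree K j).card = Nat.card K ^ k := by
  have hmonic (j : ℕ) : ∀ P ∈ primesOfDegree K j, P.Monic := fun _ hP =>
    (mem_primesOfDegree.1 hP).1
  rw [← FiniteField.X_pow_card_pow_sub_X_natDegree_eq K hk Finite.one_lt_card,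
    ← prod_primesOfDegree_eq hk,
    natDegree_prod_of_monic _ _ fun j _ => monic_prod_of_monic _ _ (hmonic j)]
  refine Finset.sum_congr rfl fun j _ => ?_
  rw [natDegree_prod_of_monic _ _ (hmonic j),
    Finset.sum_congr rfl fun P hP => (mem_primesOfDegree.1 hP).2.2, Finset.sum_const,
    smul_eq_mul, mul_comm]

theorem card_primesOfDegree_one : (primesOfDegree K 1).card = Nat.card K := by
  simpa using sum_divisors_mul_card_primesOfDegree (K := K) one_ne_zero

theorem card_primesOfDegree_of_prime {p : ℕ} (hp : p.Prime) :
    p * (primesOfDegree K p).card + Nat.card K = Nat.card K ^ p := by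
  have h := sum_divisors_mul_card_primesOfDegree (K := K) hp.ne_zero
  rw [hp.sum_divisors, one_mul, card_primesOfDegree_one] at h
  exact h

/-- If all proper divisors of `k` are below `m`, the primes of degree properly dividing `k` take
away at most `q + ⋯ + q ^ (m - 1)` from the total degree `q ^ k`. -/
theorem card_pow_le {k m : ℕ} (hk : k ≠ 0) (hm : ∀ j ∈ k.properDivisors, j < m) :
    Nat.card K ^ k ≤ k * (primesOfDegree K k).card + ∑ j ∈ Finset.Ico 1 m, Nat.card K ^ j := by
  have hle (j : ℕ) (hj : j ≠ 0) : j * (primesOfDegree K j).card ≤ Nat.card K ^ j := by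
    rw [← sum_divisors_mul_card_primesOfDegree hj]
    exact Finset.single_le_sum (f := fun i => i * (primesOfDegree K i).card)
      (fun _ _ => Nat.zero_le _) (Nat.mem_divisors_self j hj)
  rw [← sum_divisors_mul_card_primesOfDegree hk, ← Nat.insert_self_properDivisors hk,
    Finset.sum_insert Nat.self_notMem_properDivisors]
  refine Nat.add_le_add_left ?_ _
  calc ∑ j ∈ k.properDivisors, j * (primesOfDegree K j).card
      ≤ ∑ j ∈ k.properDivisors, Nat.card K ^ j :=
        Finset.sum_le_sum fun j hj => hle j (Nat.pos_of_mem_properDivisors hj).ne'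
    _ ≤ ∑ j ∈ Finset.Ico 1 m, Nat.card K ^ j :=
        Finset.sum_le_sum_of_subset fun j hj =>
          Finset.mem_Ico.2 ⟨Nat.pos_of_mem_properDivisors hj, hm j hj⟩

theorem mul_sum_Ico_pow_add (r m : ℕ) :
    r * ∑ j ∈ Finset.Ico 1 (m + 1), (r + 1) ^ j + (r + 1) = (r + 1) ^ (m + 1) := by
  induction m with
  | zero => simp
  | succ m ih =>
    rw [Finset.sum_Ico_succ_top (by omega)]
    linear_combination ih

theorem three_le_card_primesOfDegree (hK : Nat.card K = 2) {k : ℕ} (hk : 4 ≤ k) :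
    3 ≤ (primesOfDegree K k).card := by
  obtain ⟨t, rfl⟩ := Nat.exists_eq_add_of_le' hk
  have hm : ∀ j ∈ (t + 4).properDivisors, j < t + 3 := by
    intro j hj
    obtain ⟨⟨c, hc⟩, hlt⟩ := Nat.mem_properDivisors.1 hj
    have hc2 : 2 ≤ c := (lt_mul_iff_one_lt_right (Nat.pos_of_mem_properDivisors hj)).1 (hc ▸ hlt)
    have := Nat.mul_le_mul_left j hc2
    omega
  have hsum := card_pow_le (K := K) (by omega) hm
  have hgeom : ∑ j ∈ Finset.Ico 1 (t + 3), 2 ^ j + 2 = 2 ^ (t + 3) := by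
    simpa only [one_mul, one_add_one_eq_two] using mul_sum_Ico_pow_add 1 (t + 2)
  have ht : t < 2 ^ t := Nat.lt_two_pow_self
  rw [hK] at hsum
  refine Nat.lt_of_mul_lt_mul_left (a := t + 4) ?_
  rw [pow_add] at hsum hgeom
  omega

theorem card_primesOfDegree_two (hK : Nat.card K = 2) : (primesOfDegree K 2).card = 1 := by
  have h := card_primesOfDegree_of_prime (K := K) Nat.prime_two
  rw [hK] at h
  omega

theorem two_le_card_primesOfDegree_of_ne_two (hK : Nat.card K = 2) {k : ℕ}
    (hk₀ : k ≠ 0) (hk₂ : k ≠ 2) : 2 ≤ (primesOfDegree K k).card := by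
  obtain rfl | rfl | hk : k = 1 ∨ k = 3 ∨ 4 ≤ k := by omega
  · rw [card_primesOfDegree_one, hK]
  · have h := card_primesOfDegree_of_prime (K := K) Nat.prime_three
    rw [hK] at h
    omega
  · exact (Nat.le_succ 2).trans (three_le_card_primesOfDegree hK hk)

theorem two_le_card_primesOfDegree (hK : Nat.card K = 3) {k : ℕ} (hk : k ≠ 0) :
    2 ≤ (primesOfDegree K k).card := by
  obtain ⟨t, rfl⟩ := Nat.exists_eq_add_one_of_ne_zero hk
  have hsum := card_pow_le (K := K) hk fun j hj => (Nat.mem_properDivisors.1 hj).2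
  have hgeom : 2 * ∑ j ∈ Finset.Ico 1 (t + 1), 3 ^ j + 3 = 3 ^ (t + 1) :=
    mul_sum_Ico_pow_add 2 t
  have ht : t < 3 ^ t := Nat.lt_pow_self (by norm_num)
  rw [hK] at hsum
  refine Nat.lt_of_mul_lt_mul_left (a := t + 1) ?_
  rw [pow_succ] at hsum hgeom
  omega

end PrimeCount

section Bounds

open Polynomial Finset

variable {K : Type*} [Field K] {d n : ℕ} {F G : K[X]} {v : Fin n → ExpTuple}
  {A B : Fin (n + 1) → K[X]} {ι κ : Type*} [Fintype ι] [Fintype κ] {P : ι → K[X]} {f : ι → ℕ}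
  {Q : κ → K[X]} {e : κ → ℕ}

namespace IsDecomposition

theorem exists_prime_dvd_natDegree_eq (h : IsDecomposition d F G v A B) (i : Fin n) :
    ∃ R : K[X], R.Monic ∧ Irreducible R ∧ R.natDegree = (v i).val 0 ∧ R ∣ B i.succ := by
  obtain ⟨R, hR, -, hB⟩ := mem_chainSet_iff.1 (h.mem_chainSet i)
  have hone : 1 ∈ Icc 1 (v i).len := left_mem_Icc.2 (v i).one_le_len
  have hone' := mem_Icc_len_succ hone
  refine ⟨R 1, hR.monic 1 hone', hR.irreducible 1 hone',
    (hR.natDegree_eq 1 hone').trans (v i).deg_one, ?_⟩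
  rw [hB]
  exact (dvd_pow_self _ ((v i).val_pos 1 (v i).one_le_len).ne').trans
    (dvd_prod_of_mem (fun k => R k ^ (v i).val k) hone)

theorem card_natDegree_add_card_val_le [Finite K] (h : IsDecomposition d F G v A B)
    (hQ : IsFactorization (B 0) Q e) (k : ℕ) :
    #{j | (Q j).natDegree = k} + #{i | (v i).val 0 = k} ≤ #(primesOfDegree K k) := by
  choose R hm hi hd hdvd using h.exists_prime_dvd_natDegree_eq
  have hdisj (i j) (x : K[X]) (hx : Irreducible x) (hxi : x ∣ B i) (hxj : x ∣ B j) : i = j := by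
    by_contra hij
    exact hx.not_isUnit ((h.coprime_right i j hij).isUnit_of_dvd' hxi hxj)
  have hQdvd (j) : Q j ∣ B 0 := (dvd_pow_self _ (hQ.pos j).ne').trans (hQ.pow_dvd j)
  have hinj : Function.Injective (Sum.elim Q R) := by
    refine hQ.injective.sumElim (fun i j hij => ?_) fun j i hij => ?_
    · exact Fin.succ_injective _ (hdisj _ _ (R i) (hi i) (hdvd i) (hij ▸ hdvd j))
    · exact Fin.succ_ne_zero i (hdisj _ _ (R i) (hi i) (hdvd i) (hij ▸ hQdvd j))
  rw [← card_filter_sumElim_eq]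
  refine card_le_card_of_injOn (Sum.elim Q R) (fun x hx => ?_) hinj.injOn
  rw [coe_filter, Set.mem_ofPred_eq] at hx
  rw [mem_coe, mem_primesOfDegree]
  cases x with
  | inl j => exact ⟨hQ.monic j, hQ.irreducible j, hx.2⟩
  | inr i => exact ⟨hm i, hi i, (hd i).trans hx.2⟩

theorem left_ne_zero (h : IsDecomposition d F G v A B) (hF : F ≠ 0) (i : Fin (n + 1)) :
    A i ≠ 0 :=
  prod_ne_zero_iff.1 (h.prod_left ▸ hF) i (mem_univ i)

theorem right_ne_zero (h : IsDecomposition d F G v A B) (hG : G ≠ 0) (i : Fin (n + 1)) :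
    B i ≠ 0 :=
  prod_ne_zero_iff.1 (h.prod_right ▸ hG) i (mem_univ i)

theorem card_val_le [Finite K] (h : IsDecomposition d F G v A B) (hG : G ≠ 0) (k : ℕ) :
    #{i | (v i).val 0 = k} ≤ #(primesOfDegree K k) := by
  obtain ⟨m, Q, e, hQ⟩ := exists_isFactorization (h.right_ne_zero hG 0)
  exact (Nat.le_add_left _ _).trans (h.card_natDegree_add_card_val_le hQ k)

theorem sum_card_natDegree_mul_factorization_eq [Finite K] (h : IsDecomposition d F G v A B)
    (hP : IsFactorization (A 0) P f) (hQ : IsFactorization (B 0) Q e)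
    (hFG : phi K F = sigma K G) (hqd : IsZsigmondyBound (Nat.card K) d) (hd : d ≠ 0) (r : ℕ) :
    ∑ k ∈ d.divisors,
        (#{i | (P i).natDegree = k} + #{j | (Q j).natDegree = k} + #{i | (v i).val 0 = k}) *
          (Nat.card K ^ k - 1).factorization r =
      ∑ k ∈ d.divisors,
        #{j | (e j + 1) * (Q j).natDegree = k} * (Nat.card K ^ k - 1).factorization r := by
  have hprod := prod_pow_sub_one_eq_of_phi_mul_eq_sigma hP hQ
    ((h.phi_eq_sigma_iff hQ.ne_zero).1 hFG)
  have hsum := PhiSigma.sum_divisors_card_mul_factorization_eq Finite.one_lt_card hqd hd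
    (a := Sum.elim (Sum.elim (fun i => (P i).natDegree) fun j => (Q j).natDegree)
      fun i => (v i).val 0) (b := fun j => (e j + 1) * (Q j).natDegree) ?_ ?_ ?_ r
  · simpa only [card_filter_sumElim_eq] using hsum
  · rintro ((i | j) | i)
    · exact (hP.irreducible i).natDegree_pos
    · exact (hQ.irreducible j).natDegree_pos
    · exact (v i).val_pos 0 (Nat.zero_le _)
  · exact fun j => Nat.mul_pos (Nat.succ_pos _) (hQ.irreducible j).natDegree_pos
  · simpa only [Fintype.prod_sum_type, Sum.elim_inl, Sum.elim_inr] using hprod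

theorem sum_divisors_card_val_eq (h : IsDecomposition d F G v A B) (hd : d ≠ 0) :
    ∑ k ∈ d.divisors, #{i | (v i).val 0 = k} = n := by
  rw [← card_eq_sum_card_fiberwise fun i _ => mem_coe.2 (Nat.mem_divisors.2 ⟨h.dvd i, hd⟩),
    card_univ, Fintype.card_fin]

theorem le_two_of_card_eq_three (hK : Nat.card K = 3) (h : IsDecomposition 2 F G v A B)
    (hF : F ≠ 0) (hG : G ≠ 0) (hFG : phi K F = sigma K G) : n ≤ 2 := by
  have : Finite K := Nat.finite_of_card_ne_zero (by omega)
  obtain ⟨l, P, f, hP⟩ := exists_isFactorization (h.left_ne_zero hF 0)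
  obtain ⟨m, Q, e, hQ⟩ := exists_isFactorization (h.right_ne_zero hG 0)
  have hdivisors (g : ℕ → ℕ) : ∑ k ∈ Nat.divisors 2, g k = g 1 + g 2 :=
    Nat.prime_two.sum_divisors.trans (add_comm _ _)
  have hn := h.sum_divisors_card_val_eq two_ne_zero
  have hval := h.sum_card_natDegree_mul_factorization_eq hP hQ hFG
    (hK ▸ isZsigmondyBound_of_three_le le_rfl) two_ne_zero 2
  have hlin := h.card_natDegree_add_card_val_le hQ 1
  have hone : #{j | (e j + 1) * (Q j).natDegree = 1} = 0 := by
    refine card_filter_eq_zero_iff.2 fun j _ hj => ?_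
    have := hQ.natDegree_pos j
    have := hQ.two_mul_natDegree_le j
    omega
  have htwo : #{j | (e j + 1) * (Q j).natDegree = 2} ≤ #{j | (Q j).natDegree = 1} := by
    refine card_le_card (monotone_filter_right _ fun j _ hj => ?_)
    have := hQ.natDegree_pos j
    have := hQ.two_mul_natDegree_le j
    omega
  rw [card_primesOfDegree_one, hK] at hlin
  rw [hdivisors] at hn
  rw [hdivisors, hdivisors, hK, hone, show (3 ^ 1 - 1 : ℕ).factorization 2 = 1 by decide +kernel,
    show (3 ^ 2 - 1 : ℕ).factorization 2 = 3 by decide +kernel] at hval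
  omega

theorem le_three_of_card_eq_two (hK : Nat.card K = 2) (h : IsDecomposition 6 F G v A B)
    (hF : F ≠ 0) (hG : G ≠ 0) (hFG : phi K F = sigma K G) : n ≤ 3 := by
  have : Finite K := Nat.finite_of_card_ne_zero (by omega)
  obtain ⟨l, P, f, hP⟩ := exists_isFactorization (h.left_ne_zero hF 0)
  obtain ⟨m, Q, e, hQ⟩ := exists_isFactorization (h.right_ne_zero hG 0)
  have hdivisors (g : ℕ → ℕ) : ∑ k ∈ Nat.divisors 6, g k = g 1 + g 2 + g 3 + g 6 := by
    rw [show Nat.divisors 6 = {1, 2, 3, 6} by decide]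
    simp [add_assoc]
  have hn := h.sum_divisors_card_val_eq (by norm_num)
  have hval := h.sum_card_natDegree_mul_factorization_eq hP hQ hFG
    (hK ▸ isZsigmondyBound_two) (by norm_num) 7
  have hlin := h.card_natDegree_add_card_val_le hQ 1
  have hquad := h.card_natDegree_add_card_val_le hQ 2
  have hle : #{j | (e j + 1) * (Q j).natDegree = 3} + #{j | (e j + 1) * (Q j).natDegree = 6} ≤
      #{j | (Q j).natDegree = 1} + #{j | (Q j).natDegree = 2} + #{j | (Q j).natDegree = 3} := by
    calc _ = #{j | (e j + 1) * (Q j).natDegree = 3 ∨ (e j + 1) * (Q j).natDegree = 6} := by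
          rw [filter_or, card_union_of_disjoint (disjoint_filter.2 fun _ _ => by omega)]
      _ ≤ #{j | ((Q j).natDegree = 1 ∨ (Q j).natDegree = 2) ∨ (Q j).natDegree = 3} := by
          refine card_le_card (monotone_filter_right _ fun j _ hj => ?_)
          have := hQ.natDegree_pos j
          have := hQ.two_mul_natDegree_le j
          omega
      _ ≤ _ := by
          rw [filter_or, filter_or]
          exact (card_union_le _ _).trans (Nat.add_le_add_right (card_union_le _ _) _)
  rw [card_primesOfDegree_one, hK] at hlin
  rw [card_primesOfDegree_two hK] at hquad
  rw [hdivisors] at hn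
  rw [hdivisors, hdivisors, hK, show (2 ^ 1 - 1 : ℕ).factorization 7 = 0 by decide +kernel,
    show (2 ^ 2 - 1 : ℕ).factorization 7 = 0 by decide +kernel,
    show (2 ^ 3 - 1 : ℕ).factorization 7 = 1 by decide +kernel,
    show (2 ^ 6 - 1 : ℕ).factorization 7 = 1 by decide +kernel] at hval
  omega

theorem not_val_eq_two_of_ne (hK : Nat.card K = 2) (h : IsDecomposition d F G v A B)
    (hG : G ≠ 0) {i j : Fin n} (hij : i ≠ j) : ¬ ((v i).val 0 = 2 ∧ (v j).val 0 = 2) := by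
  rintro ⟨hi, hj⟩
  have : Finite K := Nat.finite_of_card_ne_zero (by omega)
  have hle := h.card_val_le hG 2
  have hlt : 1 < #{i | (v i).val 0 = 2} :=
    one_lt_card.2 ⟨i, mem_filter_univ _ |>.2 hi, j, mem_filter_univ _ |>.2 hj, hij⟩
  rw [card_primesOfDegree_two hK] at hle
  omega

theorem le_card_of_forall_val_eq_one [Finite K] (h : IsDecomposition d F G v A B) (hG : G ≠ 0)
    (hv : ∀ i, (v i).val 0 = 1) : n ≤ Nat.card K := by
  have hle := h.card_val_le hG 1
  rwa [filter_true_of_mem fun i _ => hv i, card_univ, Fintype.card_fin,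
    card_primesOfDegree_one] at hle

end IsDecomposition

end Bounds

section AbstractChains

variable {ι β : Type*}

theorem eq_of_iterate_eq {top : ι → β} {prev : β → β} {s : Set β} (htop : Function.Injective top)
    (hprev : Set.InjOn prev sᶜ) (hne : ∀ i, ∀ y ∉ s, top i ≠ prev y) {i j : ι} {k l : ℕ}
    (hk : ∀ k' < k, prev^[k'] (top i) ∉ s) (hl : ∀ l' < l, prev^[l'] (top j) ∉ s)
    (h : prev^[k] (top i) = prev^[l] (top j)) : i = j ∧ k = l := by
  induction k generalizing l with
  | zero =>
    cases l with
    | zero => exact ⟨htop h, rfl⟩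
    | succ l =>
      rw [Function.iterate_succ_apply'] at h
      exact absurd h (hne i _ (hl l l.lt_succ_self))
  | succ k ih =>
    cases l with
    | zero =>
      rw [Function.iterate_succ_apply'] at h
      exact absurd h.symm (hne j _ (hk k k.lt_succ_self))
    | succ l =>
      rw [Function.iterate_succ_apply', Function.iterate_succ_apply'] at h
      obtain ⟨rfl, rfl⟩ := ih (fun k' hk' => hk k' (hk'.trans k.lt_succ_self))
        (fun l' hl' => hl l' (hl'.trans l.lt_succ_self))
        (hprev (hk k k.lt_succ_self) (hl l l.lt_succ_self) h)
      exact ⟨rfl, rfl⟩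

theorem exists_iterate_eq [Finite β] {top : ι → β} {prev : β → β} {s u : Set β} (b : β → ℕ)
    (hcover : ∀ y ∈ u, (∃ i, top i = y) ∨ ∃ z ∈ u, z ∉ s ∧ b y < b z ∧ prev z = y) {y : β}
    (hy : y ∈ u) : ∃ i k, prev^[k] (top i) = y ∧ ∀ l < k, prev^[l] (top i) ∉ s := by
  obtain ⟨N, hN⟩ := (Set.finite_range b).bddAbove
  replace hN (z) : b z ≤ N := hN ⟨z, rfl⟩
  induction hr : N - b y using Nat.strong_induction_on generalizing y with
  | _ r ih =>
    rcases hcover y hy with ⟨i, rfl⟩ | ⟨z, hz, hzs, hlt, rfl⟩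
    · exact ⟨i, 0, rfl, fun l hl => absurd hl l.not_lt_zero⟩
    · have hzN := hN z
      obtain ⟨i, k, rfl, hk⟩ := ih (N - b z) (by omega) hz rfl
      refine ⟨i, k + 1, Function.iterate_succ_apply' _ _ _, fun l hl => ?_⟩
      rcases Nat.lt_succ_iff_lt_or_eq.1 hl with hl | rfl
      · exact hk l hl
      · exact hzs

/-- The elements `y` with `t y ∤ d` are arranged in chains `c i 1, …, c i (m i)`, one for each `i`,
in which the weight `b` of an element is the target `t` of its predecessor. In the application,
`b` and `a` are the degrees of the primes `P ^ e` dividing `G` and of those dividing `F`, and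
`t = (e + 1) * b`. -/
structure IsChainSystem (a : ι → ℕ) (b t : β → ℕ) (d : ℕ) (m : ι → ℕ) (c : ι → ℕ → β) : Prop where
  one_le (i) : 1 ≤ m i
  dvd (i) : b (c i 1) ∣ d
  succ (i) : ∀ k ∈ Finset.Ico 1 (m i), b (c i (k + 1)) = t (c i k)
  last (i) : a i = t (c i (m i))
  injective : ∀ i, ∀ k ∈ Finset.Icc 1 (m i), ∀ j, ∀ l ∈ Finset.Icc 1 (m j),
    c i k = c j l → i = j ∧ k = l
  not_dvd_iff (y) : ¬ t y ∣ d ↔ ∃ i, ∃ k ∈ Finset.Icc 1 (m i), c i k = y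

variable [Fintype ι] [Fintype β] {a : ι → ℕ} {b t : β → ℕ} {d : ℕ}

theorem card_filter_comp_eq {κ : Type*} [Fintype κ] {x : κ → ι} (hx : Function.Injective x) {k : ℕ}
    (hk : ∀ i, a i = k → i ∈ Set.range x) :
    Finset.card {j | a (x j) = k} = Finset.card {i | a i = k} := by
  refine Finset.card_nbij x (fun j hj => ?_) hx.injOn fun i hi => ?_
  · simpa using hj
  · rw [Finset.mem_coe, Finset.mem_filter_univ] at hi
    obtain ⟨j, rfl⟩ := hk i hi
    exact ⟨j, by simpa using hi, rfl⟩

theorem exists_equiv_of_card_filter_eq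
    (hcount : ∀ n, ¬ n ∣ d →
      Finset.card {i | a i = n} + Finset.card {y | b y = n} = Finset.card {y | t y = n}) :
    ∃ E : {w : ι ⊕ β // ¬ Sum.elim a b w ∣ d} ≃ {y : β // ¬ t y ∣ d},
      ∀ w, t (E w).1 = Sum.elim a b w.1 := by
  have hfiber (c : ℕ) : Nonempty ({w : {w : ι ⊕ β // ¬ Sum.elim a b w ∣ d} //
      Sum.elim a b w.1 = c} ≃ {y : {y : β // ¬ t y ∣ d} // t y.1 = c}) := by
    by_cases hc : c ∣ d
    · have : IsEmpty {w : {w : ι ⊕ β // ¬ Sum.elim a b w ∣ d} // Sum.elim a b w.1 = c} :=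
        ⟨fun w => w.1.2 (by rwa [w.2])⟩
      have : IsEmpty {y : {y : β // ¬ t y ∣ d} // t y.1 = c} := ⟨fun y => y.1.2 (by rwa [y.2])⟩
      exact ⟨Equiv.equivOfIsEmpty _ _⟩
    · have hcard : Fintype.card {w // Sum.elim a b w = c} = Fintype.card {y // t y = c} := by
        rw [Fintype.card_subtype, Fintype.card_subtype, card_filter_sumElim_eq, hcount c hc]
      have hl {w} (h : Sum.elim a b w = c) : ¬ Sum.elim a b w ∣ d := h.symm ▸ hc
      have hr {y} (h : t y = c) : ¬ t y ∣ d := h.symm ▸ hc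
      exact ⟨(Equiv.subtypeSubtypeEquivSubtype hl).trans
        ((Fintype.equivOfCardEq hcard).trans (Equiv.subtypeSubtypeEquivSubtype hr).symm)⟩
  exact ⟨Equiv.ofFiberEquiv fun c => (hfiber c).some,
    Equiv.ofFiberEquiv_map (g := fun y : {y : β // ¬ t y ∣ d} => t y.1) _⟩

theorem exists_top_prev (ha : ∀ i, ¬ a i ∣ d)
    (hcount : ∀ n, ¬ n ∣ d →
      Finset.card {i | a i = n} + Finset.card {y | b y = n} = Finset.card {y | t y = n}) :
    ∃ (top : ι → β) (prev : β → β), Function.Injective top ∧ Set.InjOn prev {y | b y ∣ d}ᶜ ∧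
      (∀ i, ∀ y ∉ {y | b y ∣ d}, top i ≠ prev y) ∧ (∀ i, t (top i) = a i) ∧
      (∀ y ∉ {y | b y ∣ d}, t (prev y) = b y) ∧
      ∀ y, ¬ t y ∣ d → (∃ i, top i = y) ∨ ∃ z ∉ {y | b y ∣ d}, prev z = y := by
  classical
  obtain ⟨E, hE⟩ := exists_equiv_of_card_filter_eq hcount
  have hEinj {w w'} (h : (E w : β) = E w') : w.1 = w'.1 :=
    congrArg Subtype.val (E.injective (Subtype.ext h))
  let prev (y : β) : β := if hy : b y ∣ d then y else E ⟨Sum.inr y, hy⟩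
  have hprev {y} (hy : y ∉ {y | b y ∣ d}) : prev y = E ⟨Sum.inr y, hy⟩ := dif_neg hy
  refine ⟨fun i => E ⟨Sum.inl i, ha i⟩, prev, fun i j h => Sum.inl_injective (hEinj h),
    fun y hy z hz h => ?_, fun i y hy h => ?_, fun i => hE _, fun y hy => ?_, fun y hy => ?_⟩
  · rw [hprev hy, hprev hz] at h
    exact Sum.inr_injective (hEinj h)
  · rw [hprev hy] at h
    exact Sum.inl_ne_inr (hEinj h)
  · rw [hprev hy, hE, Sum.elim_inr]
  · obtain ⟨⟨i | z, hw⟩, hEw⟩ := E.surjective ⟨y, hy⟩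
    · exact Or.inl ⟨i, congrArg Subtype.val hEw⟩
    · exact Or.inr ⟨z, hw, (hprev hw).trans (congrArg Subtype.val hEw)⟩

/-- A chain is followed backwards from its last element: the target of the predecessor of `y` is the
weight of `y`, until this weight divides `d`. -/
theorem exists_isChainSystem (ha : ∀ i, ¬ a i ∣ d) (hlt : ∀ y, b y < t y) (hdvd : ∀ y, b y ∣ t y)
    (hcount : ∀ n, ¬ n ∣ d →
      Finset.card {i | a i = n} + Finset.card {y | b y = n} = Finset.card {y | t y = n}) :
    ∃ (m : ι → ℕ) (c : ι → ℕ → β), IsChainSystem a b t d m c := by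
  classical
  obtain ⟨top, prev, htop, hprev, hne, hta, htb, hcover⟩ := exists_top_prev ha hcount
  have hterm (i) : ∃ k, prev^[k] (top i) ∈ {y | b y ∣ d} := by
    by_contra! hno
    refine not_strictAnti_of_wellFoundedLT (fun k => b (prev^[k] (top i)))
      (strictAnti_nat_of_succ_lt fun k => ?_)
    rw [Function.iterate_succ_apply']
    exact (hlt _).trans_eq (htb _ (hno k))
  let r (i : ι) : ℕ := Nat.find (hterm i)
  have hr {i k} (hk : k < r i) : prev^[k] (top i) ∉ {y | b y ∣ d} := Nat.find_min (hterm i) hk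
  refine ⟨fun i => r i + 1, fun i k => prev^[r i + 1 - k] (top i), fun i => by omega,
    fun i => Nat.find_spec (hterm i), fun i k hk => ?_, fun i => ?_, fun i k hk j l hl h => ?_,
    fun y => ⟨fun hy => ?_, ?_⟩⟩
  · rw [Finset.mem_Ico] at hk
    rw [Nat.add_sub_add_right, Nat.sub_add_comm (by omega), Function.iterate_succ_apply',
      htb _ (hr (by omega))]
  · rw [Nat.sub_self, Function.iterate_zero_apply, hta]
  · rw [Finset.mem_Icc] at hk hl
    obtain ⟨rfl, hkl⟩ := eq_of_iterate_eq htop hprev hne (fun k' hk' => hr (by omega))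
      (fun l' hl' => hr (by omega)) h
    exact ⟨rfl, by omega⟩
  · obtain ⟨i, k, rfl, hk⟩ := exists_iterate_eq (s := {y | b y ∣ d}) (u := {y | ¬ t y ∣ d}) b
      (fun y hy => (hcover y hy).imp_right fun ⟨z, hz, hzy⟩ =>
        ⟨z, fun hd => hz ((hdvd z).trans hd), hz, hzy ▸ (hlt _).trans_eq (htb z hz), hzy⟩) hy
    have hkr : k ≤ r i := (Nat.le_find_iff _ _).2 hk
    refine ⟨i, r i + 1 - k, Finset.mem_Icc.2 (by omega), ?_⟩
    rw [Nat.sub_sub_self (by omega)]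
  · rintro ⟨i, k, hk, rfl⟩
    rw [Finset.mem_Icc] at hk
    obtain ⟨l, hl⟩ : ∃ l, r i + 1 - k = l := ⟨_, rfl⟩
    rw [hl]
    cases l with
    | zero => exact hta i ▸ ha i
    | succ l =>
      rw [Function.iterate_succ_apply', htb _ (hr (by omega))]
      exact hr (by omega)

theorem IsChainSystem.prod_filter_eq {m : ι → ℕ} {c : ι → ℕ → β} (h : IsChainSystem a b t d m c)
    {M : Type*} [CommMonoid M] (f : β → M) :
    ∏ y with ¬ t y ∣ d, f y = ∏ i, ∏ k ∈ Finset.Icc 1 (m i), f (c i k) := by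
  rw [Finset.prod_sigma']
  refine (Finset.prod_nbij (fun p : (_ : ι) × ℕ => c p.1 p.2) (fun p hp => ?_)
    (fun p hp p' hp' hpp' => ?_) (fun y hy => ?_) fun _ _ => rfl).symm
  · exact Finset.mem_filter.2 ⟨Finset.mem_univ _,
      (h.not_dvd_iff _).2 ⟨p.1, p.2, (Finset.mem_sigma.1 hp).2, rfl⟩⟩
  · obtain ⟨i, k⟩ := p
    obtain ⟨j, l⟩ := p'
    obtain ⟨rfl, rfl⟩ := h.injective i k (Finset.mem_sigma.1 hp).2 j l (Finset.mem_sigma.1 hp').2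
      hpp'
    rfl
  · obtain ⟨i, k, hk, rfl⟩ := (h.not_dvd_iff y).1 (Finset.mem_filter.1 hy).2
    exact ⟨⟨i, k⟩, Finset.mem_sigma.2 ⟨Finset.mem_univ _, hk⟩, rfl⟩

end AbstractChains

section Decompositions

open Polynomial

variable {K : Type*} [Field K]

namespace IsFactorization

variable {ι : Type*} [Fintype ι] {G : K[X]} {P : ι → K[X]} {e : ι → ℕ}

theorem natDegree_eq (h : IsFactorization G P e) :
    G.natDegree = ∑ i, e i * (P i).natDegree := by
  rw [natDegree_eq_of_degree_eq (degree_eq_degree_of_associated h.associated),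
    natDegree_prod_of_monic _ _ fun i _ => (h.monic i).pow _]
  exact Finset.sum_congr rfl fun i _ => natDegree_pow _ _

theorem natDegree_le [Finite K] (h : IsFactorization G P e) {d : ℕ}
    (hd : ∀ i, e i * (P i).natDegree ≤ d) :
    G.natDegree ≤ (finite_setOf_natDegree_le (K := K) d).toFinset.card * d := by
  classical
  rw [h.natDegree_eq]
  refine (Finset.sum_le_card_nsmul _ _ d fun i _ => hd i).trans (Nat.mul_le_mul_right d ?_)
  refine Finset.card_le_card_of_injOn P (fun i _ => ?_) h.injective.injOn
  rw [Finset.mem_coe, Set.Finite.mem_toFinset]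
  exact (Nat.le_mul_of_pos_left _ (h.pos i)).trans (hd i)

theorem squarefree_iff (h : IsFactorization G P e) : Squarefree G ↔ ∀ i, e i = 1 := by
  refine ⟨fun hG i => ?_, fun he => ?_⟩
  · have hpos := h.pos i
    by_contra hne
    refine (h.irreducible i).not_isUnit (hG (P i) ?_)
    rw [← pow_two]
    exact (pow_dvd_pow _ (by omega)).trans (h.pow_dvd i)
  · rw [squarefree_iff_irreducible_sq_not_dvd_of_ne_zero h.ne_zero]
    intro Q hQ hd
    obtain ⟨i, hi⟩ := h.exists_associated_of_dvd hQ ((dvd_mul_right Q Q).trans hd)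
    refine h.not_pow_succ_dvd i ?_
    rw [he i, pow_two]
    exact (hi.mul_mul hi).dvd_iff_dvd_left.1 hd

theorem eq_of_pow_dvd_of_not_pow_succ_dvd (h : IsFactorization G P e) {i : ι} {k : ℕ}
    (hk : P i ^ k ∣ G) (hk' : ¬ P i ^ (k + 1) ∣ G) : k = e i := by
  refine le_antisymm ?_ ?_
  · by_contra! hlt
    exact h.not_pow_succ_dvd i ((pow_dvd_pow _ hlt).trans hk)
  · by_contra! hlt
    exact hk' ((pow_dvd_pow _ hlt).trans (h.pow_dvd i))

theorem exists_eq_of_monic_of_dvd (h : IsFactorization G P e) {Q : K[X]} (hQm : Q.Monic)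
    (hQ : Irreducible Q) (hd : Q ∣ G) : ∃ i, Q = P i :=
  (h.exists_associated_of_dvd hQ hd).imp fun i => eq_of_monic_of_associated hQm (h.monic i)

theorem exists_subtype (h : IsFactorization G P e) (p : ι → Prop) [DecidablePred p] :
    ∃ H, IsFactorization H (fun i : {i // p i} => P i) (fun i => e i) ∧
      G = H * ∏ i with ¬ p i, P i ^ e i := by
  obtain ⟨u, hu⟩ := h.associated.symm
  refine ⟨(∏ i : {i // p i}, P i ^ e i) * u, ⟨fun i => h.monic i, fun i => h.irreducible i,
    h.injective.comp Subtype.val_injective, fun i => h.pos i, u⁻¹, ?_⟩, ?_⟩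
  · rw [mul_assoc, Units.mul_inv, mul_one]
  · rw [← hu, mul_right_comm, ← Fintype.prod_subtype_mul_prod_subtype p]
    congr 2
    exact (Finset.prod_subtype {i | ¬ p i} (by simp) fun i => P i ^ e i).symm

end IsFactorization

theorem mem_exceptionalSet_iff {ι κ : Type*} [Fintype ι] [Fintype κ] {d : ℕ} {F G : K[X]}
    {P : ι → K[X]} {f : ι → ℕ} {Q : κ → K[X]} {e : κ → ℕ} (hP : IsFactorization F P f)
    (hQ : IsFactorization G Q e) :
    (F, G) ∈ exceptionalSet K d ↔
      (∀ i, f i = 1 ∧ (P i).natDegree ∣ d) ∧ ∀ j, (e j + 1) * (Q j).natDegree ∣ d := by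
  have hdeg {R S : K[X]} (h : Associated R S) : R.natDegree = S.natDegree :=
    natDegree_eq_of_degree_eq (degree_eq_degree_of_associated h)
  constructor
  · rintro ⟨hsq, hF, -, hG⟩
    exact ⟨fun i => ⟨hP.squarefree_iff.1 hsq i,
        hF _ (hP.irreducible i) ((dvd_pow_self _ (hP.pos i).ne').trans (hP.pow_dvd i))⟩,
      fun j => hG _ _ (hQ.irreducible j) (hQ.pos j) (hQ.pow_dvd j) (hQ.not_pow_succ_dvd j)⟩
  · rintro ⟨hF, hG⟩
    refine ⟨hP.squarefree_iff.2 fun i => (hF i).1, fun R hR hd => ?_, hQ.ne_zero,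
      fun R k hR hk hd hd' => ?_⟩
    · obtain ⟨i, hi⟩ := hP.exists_associated_of_dvd hR hd
      exact hdeg hi ▸ (hF i).2
    · obtain ⟨j, hj⟩ := hQ.exists_associated_of_dvd hR ((dvd_pow_self R hk.ne').trans hd)
      rw [hj.pow_pow.dvd_iff_dvd_left] at hd hd'
      rw [hdeg hj, hQ.eq_of_pow_dvd_of_not_pow_succ_dvd hd hd']
      exact hG j

theorem finite_exceptionalSet [Finite K] {d : ℕ} (hd : d ≠ 0) : (exceptionalSet K d).Finite := by
  set N := (finite_setOf_natDegree_le (K := K) d).toFinset.card * d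
  refine ((finite_setOf_natDegree_le (K := K) N).prod (finite_setOf_natDegree_le N)).subset ?_
  rintro ⟨F, G⟩ h
  obtain ⟨m, P, f, hP⟩ := exists_isFactorization h.1.ne_zero
  obtain ⟨n, Q, e, hQ⟩ := exists_isFactorization h.2.2.1
  obtain ⟨hF, hG⟩ := (mem_exceptionalSet_iff hP hQ).1 h
  have hle {k : ℕ} (hk : k ∣ d) : k ≤ d := Nat.le_of_dvd (Nat.pos_of_ne_zero hd) hk
  refine ⟨hP.natDegree_le fun i => ?_, hQ.natDegree_le fun j => ?_⟩
  · rw [(hF i).1, one_mul]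
    exact hle (hF i).2
  · exact (Nat.mul_le_mul_right _ (Nat.le_succ _)).trans (hle (hG j))

section

variable {ι κ : Type*} [Fintype ι] [Fintype κ] {F G : K[X]} {P : ι → K[X]} {f : ι → ℕ}
  {Q : κ → K[X]} {e : κ → ℕ} {d n : ℕ} {x : Fin n → ι} {m : Fin n → ℕ} {c : Fin n → ℕ → κ}

theorem IsChainSystem.exists_isPrimeChain (hP : IsFactorization F P f)
    (hQ : IsFactorization G Q e)
    (h : IsChainSystem (fun i => (P (x i)).natDegree) (fun j => (Q j).natDegree)
      (fun j => (e j + 1) * (Q j).natDegree) d m c) (i : Fin n) :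
    ∃ (v : ExpTuple) (R : ℕ → K[X]), IsPrimeChain v R ∧ v.len = m i ∧
      v.val 0 = (Q (c i 1)).natDegree ∧ R (m i + 1) = P (x i) ∧
      ∀ k ∈ Finset.Icc 1 (m i), v.val k = e (c i k) ∧ R k = Q (c i k) := by
  have hone := h.one_le i
  let v : ExpTuple :=
    { len := m i
      val k := if k = 0 then (Q (c i 1)).natDegree else e (c i k)
      one_le_len := hone
      val_pos k _ := by
        split_ifs
        exacts [hQ.natDegree_pos _, hQ.pos _] }
  have hval {k} (hk : 1 ≤ k) : v.val k = e (c i k) := if_neg (by omega)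
  have hdeg : ∀ k, 1 ≤ k → k ≤ m i → v.deg k = (Q (c i k)).natDegree := fun k hk => by
    induction k, hk using Nat.le_induction with
    | base => exact fun _ => v.deg_one
    | succ k hk ih =>
      intro hkm
      rw [v.deg_succ hk, hval hk, ih (by omega), h.succ i k (Finset.mem_Ico.2 ⟨hk, hkm⟩)]
  have hdeg_last : v.deg (m i + 1) = (P (x i)).natDegree := by
    rw [v.deg_succ hone, hval hone, hdeg _ hone le_rfl, h.last i]
  let R (k : ℕ) : K[X] := if k = m i + 1 then P (x i) else Q (c i k)
  have hR {k} (hk : k ≤ m i) : R k = Q (c i k) := if_neg (by omega)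
  have hR_last : R (m i + 1) = P (x i) := if_pos rfl
  have hchain (k) (hk : k ∈ Finset.Icc 1 (v.len + 1)) :
      (R k).Monic ∧ Irreducible (R k) ∧ (R k).natDegree = v.deg k := by
    obtain ⟨hk1, hkm⟩ := Finset.mem_Icc.1 hk
    rcases Nat.le_succ_iff.1 hkm with hkm | rfl
    · rw [hR hkm, hdeg k hk1 hkm]
      exact ⟨hQ.monic _, hQ.irreducible _, rfl⟩
    · exact hR_last ▸ ⟨hP.monic _, hP.irreducible _, hdeg_last.symm⟩
  exact ⟨v, R, ⟨fun k hk => (hchain k hk).1, fun k hk => (hchain k hk).2.1,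
    fun k hk => (hchain k hk).2.2⟩, rfl, rfl, hR_last, fun k hk =>
      ⟨hval (Finset.mem_Icc.1 hk).1, hR (Finset.mem_Icc.1 hk).2⟩⟩

theorem IsChainSystem.exists_isDecomposition (hP : IsFactorization F P f)
    (hQ : IsFactorization G Q e) (hf : ∀ i, f i = 1) (hx : Function.Injective x)
    (hrange : Set.range x = {i | ¬ (P i).natDegree ∣ d})
    (h : IsChainSystem (fun i => (P (x i)).natDegree) (fun j => (Q j).natDegree)
      (fun j => (e j + 1) * (Q j).natDegree) d m c) :
    ∃ (v : Fin n → ExpTuple) (A B : Fin (n + 1) → K[X]),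
      IsDecomposition d F G v A B ∧ (A 0, B 0) ∈ exceptionalSet K d ∧ ∀ i, (v i).Reduced d := by
  have hfilter : ({i | ¬ (P i).natDegree ∣ d} : Finset ι) = Finset.univ.map ⟨x, hx⟩ := by
    ext i
    simpa [eq_comm] using (Set.ext_iff.1 hrange i).symm
  choose v R hR hlen hval₀ hlast hval using h.exists_isPrimeChain hP hQ
  obtain ⟨F₀, hF₀, hF⟩ := hP.exists_subtype fun i => (P i).natDegree ∣ d
  obtain ⟨G₀, hG₀, hG⟩ := hQ.exists_subtype fun j => (e j + 1) * (Q j).natDegree ∣ d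
  have hF' : F = F₀ * ∏ i, R i ((v i).len + 1) := by
    simp only [hF, hfilter, Finset.prod_map, Function.Embedding.coeFn_mk, hf, pow_one, hlen, hlast]
  have hG' : G = G₀ * ∏ i, ∏ k ∈ Finset.Icc 1 (v i).len, R i k ^ (v i).val k := by
    rw [hG, h.prod_filter_eq]
    refine congrArg _ <|
      Finset.prod_congr rfl fun i _ => hlen i ▸ Finset.prod_congr rfl fun k hk => ?_
    rw [(hval i k (hlen i ▸ hk)).1, (hval i k (hlen i ▸ hk)).2]
  rw [hF', hG']
  refine ⟨v, _, _, isDecomposition_cons (fun i => ?_) hR (fun i j hij heq => ?_)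
    (fun i j hij k hk l hl heq => ?_) (fun i hdvd => ?_) (fun i k hk hdvd => ?_),
    (mem_exceptionalSet_iff hF₀ hG₀).2 ⟨fun i => ⟨hf i, i.2⟩, fun j => j.2⟩, fun i => ?_⟩
  · exact hval₀ i ▸ h.dvd i
  · rw [hlen, hlen, hlast, hlast] at heq
    exact hij (hx (hP.injective heq))
  · rw [hlen] at hk hl
    rw [(hval i k hk).2, (hval j l hl).2] at heq
    exact hij (h.injective i k hk j l hl (hQ.injective heq)).1
  · rw [hlen, hlast] at hdvd
    obtain ⟨j, hj⟩ := hF₀.exists_eq_of_monic_of_dvd (hP.monic _) (hP.irreducible _) hdvd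
    exact hrange.subset ⟨i, rfl⟩ (hP.injective hj ▸ j.2)
  · rw [hlen] at hk
    rw [(hval i k hk).2] at hdvd
    obtain ⟨j, hj⟩ := hG₀.exists_eq_of_monic_of_dvd (hQ.monic _) (hQ.irreducible _) hdvd
    exact (h.not_dvd_iff _).2 ⟨i, k, hk, hQ.injective hj⟩ j.2
  · have hone : 1 ∈ Finset.Icc 1 (m i) := Finset.left_mem_Icc.2 (h.one_le i)
    rw [ExpTuple.Reduced, hval₀, (hval i 1 hone).1, mul_comm]
    exact (h.not_dvd_iff _).2 ⟨i, 1, hone, rfl⟩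

theorem exists_isDecomposition (hP : IsFactorization F P f) (hQ : IsFactorization G Q e)
    (hf : ∀ i, f i = 1)
    (hcount : ∀ k, ¬ k ∣ d → Finset.card {i | (P i).natDegree = k} +
      Finset.card {j | (Q j).natDegree = k} =
        Finset.card {j | (e j + 1) * (Q j).natDegree = k}) :
    ∃ (n : ℕ) (v : Fin n → ExpTuple) (A B : Fin (n + 1) → K[X]),
      IsDecomposition d F G v A B ∧ (A 0, B 0) ∈ exceptionalSet K d ∧ ∀ i, (v i).Reduced d := by
  obtain ⟨n, x, hx, hrange⟩ := (Set.toFinite {i | ¬ (P i).natDegree ∣ d}).fin_param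
  have hlt (j) : (Q j).natDegree < (e j + 1) * (Q j).natDegree :=
    (lt_two_mul_self (hQ.natDegree_pos j)).trans_le (hQ.two_mul_natDegree_le j)
  have hcard (k) (hk : ¬ k ∣ d) :
      Finset.card {i | (P (x i)).natDegree = k} = Finset.card {i | (P i).natDegree = k} :=
    card_filter_comp_eq (a := fun i => (P i).natDegree) hx fun i hi =>
      hrange.superset (hi.symm ▸ hk : ¬ (P i).natDegree ∣ d)
  obtain ⟨m, c, hc⟩ := exists_isChainSystem (a := fun i => (P (x i)).natDegree)
    (fun i => hrange.subset ⟨i, rfl⟩) hlt (fun j => dvd_mul_left _ _)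
    fun k hk => by rw [hcard k hk, hcount k hk]
  exact ⟨n, hc.exists_isDecomposition hP hQ hf hx hrange⟩

end

theorem hasDecompositions [Finite K] {d : ℕ} (hd : d ≠ 0)
    (hqd : IsZsigmondyBound (Nat.card K) d) : HasDecompositions K d := by
  refine ⟨finite_exceptionalSet hd, fun F G hF hG hFG => ?_⟩
  obtain ⟨m, P, f, hP⟩ := exists_isFactorization hF
  obtain ⟨n, Q, e, hQ⟩ := exists_isFactorization hG
  rw [← mul_one (phi K F)] at hFG
  have hprod := prod_pow_sub_one_eq_of_phi_mul_eq_sigma hP hQ hFG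
  rw [mul_one, ← Fintype.prod_sumElim] at hprod
  refine exists_isDecomposition hP hQ (exponent_eq_one_of_phi_mul_eq_sigma hP hG hFG) fun k hk => ?_
  rw [← card_filter_sumElim_eq]
  refine card_filter_eq_of_prod_pow_sub_one_eq Finite.one_lt_card hqd ?_ ?_ ?_ hk
  · exact Sum.forall.2 ⟨hP.natDegree_pos, hQ.natDegree_pos⟩
  · exact fun j => Nat.mul_pos (Nat.succ_pos _) (hQ.natDegree_pos j)
  · simpa using hprod

end Decompositions

section Occurrence

open Polynomial

namespace ExpTuple

/-- The finite set of the degrees of the primes in a chain of type `v`. -/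
def degrees (v : ExpTuple) : Finset ℕ :=
  (Finset.Icc 1 (v.len + 1)).image v.deg

variable {v : ExpTuple} {d k : ℕ}

theorem deg_mem_degrees (hk : k ∈ Finset.Icc 1 (v.len + 1)) : v.deg k ∈ v.degrees :=
  Finset.mem_image_of_mem _ hk

theorem val_zero_dvd_of_mem_degrees (hk : k ∈ v.degrees) : v.val 0 ∣ k := by
  obtain ⟨j, -, rfl⟩ := Finset.mem_image.1 hk
  exact v.dvd_deg j

theorem pos_of_mem_degrees (hk : k ∈ v.degrees) : 0 < k := by
  obtain ⟨j, -, rfl⟩ := Finset.mem_image.1 hk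
  exact v.deg_pos j

theorem val_zero_lt_deg_len_succ (v : ExpTuple) : v.val 0 < v.deg (v.len + 1) := by
  have hlen := v.one_le_len
  rw [← v.deg_one]
  exact v.strictMonoOn_deg ⟨le_rfl, by omega⟩ ⟨by omega, le_rfl⟩ (by omega)

theorem Reduced.not_deg_dvd (h : v.Reduced d) (hk : 2 ≤ k) : ¬ v.deg k ∣ d := by
  refine fun hd => h (dvd_trans ?_ hd)
  induction k, hk using Nat.le_induction with
  | base => rw [v.deg_succ le_rfl, v.deg_one, mul_comm]
  | succ k hk ih =>
    rw [v.deg_succ (by omega)] at hd ⊢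
    exact (ih (dvd_of_mul_left_dvd hd)).mul_left _

theorem Reduced.eq_val_zero (h : v.Reduced d) (hk : k ∈ v.degrees) (hd : k ∣ d) :
    v.val 0 = k := by
  obtain ⟨j, hj, rfl⟩ := Finset.mem_image.1 hk
  rcases (Finset.mem_Icc.1 hj).1.eq_or_lt with rfl | hlt
  · exact v.deg_one.symm
  · exact absurd hd (h.not_deg_dvd hlt)

end ExpTuple

variable {K : Type*} [Field K] [Finite K]

theorem exists_prime_family {ι : Type*} [Fintype ι] (s : ι → Finset ℕ)
    (hs : ∀ k, Finset.card {x | k ∈ s x} ≤ (primesOfDegree K k).card) :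
    ∃ P : ι → ℕ → K[X], (∀ x, ∀ k ∈ s x, P x k ∈ primesOfDegree K k) ∧
      ∀ x, ∀ k ∈ s x, ∀ y, ∀ l ∈ s y, P x k = P y l → x = y := by
  have hle (k : ℕ) : (Finset.filter (fun x => k ∈ s x) .univ : Set ι).encard ≤
      (primesOfDegree K k : Set K[X]).encard := by
    simpa only [Set.encard_coe_eq_coe_finsetCard, Nat.cast_le] using hs k
  choose P hP hinj using fun k => (Finset.finite_toSet _).exists_injOn_of_encard_le (hle k)
  have hmem (x) (k) (hk : k ∈ s x) : P k x ∈ primesOfDegree K k := hP k (by simpa using hk)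
  refine ⟨fun x k => P k x, hmem, fun x k hk y l hl heq => ?_⟩
  obtain rfl : k = l := by
    rw [← (mem_primesOfDegree.1 (hmem x k hk)).2.2, ← (mem_primesOfDegree.1 (hmem y l hl)).2.2]
    exact congrArg natDegree heq
  exact hinj k (by simpa using hk) (by simpa using hl) heq

theorem exists_injective_primes {ι : Type*} [Fintype ι] (u : ι → ℕ)
    (hu : ∀ k, Finset.card {j | u j = k} ≤ (primesOfDegree K k).card) :
    ∃ U : ι → K[X], (∀ j, U j ∈ primesOfDegree K (u j)) ∧ Function.Injective U := by
  obtain ⟨U, hU, hinj⟩ := exists_prime_family (K := K) (fun j => {u j})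
    (by simpa only [Finset.mem_singleton, eq_comm] using hu)
  simp only [Finset.mem_singleton, forall_eq] at hU hinj
  exact ⟨fun j => U j (u j), hU, hinj⟩

theorem exists_disjoint_prime_families {ι κ : Type*} [Fintype ι] [Fintype κ] (s : ι → Finset ℕ)
    (w : κ → ℕ)
    (h : ∀ k, Finset.card {i | k ∈ s i} + Finset.card {j | w j = k} ≤
      (primesOfDegree K k).card) :
    ∃ (P : ι → ℕ → K[X]) (W : κ → K[X]), (∀ i, ∀ k ∈ s i, P i k ∈ primesOfDegree K k) ∧
      (∀ j, W j ∈ primesOfDegree K (w j)) ∧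
      (∀ i, ∀ k ∈ s i, ∀ j, ∀ l ∈ s j, P i k = P j l → i = j) ∧
      (∀ i, ∀ k ∈ s i, ∀ j, P i k ≠ W j) ∧ Function.Injective W := by
  obtain ⟨P, hP, hinj⟩ := exists_prime_family (K := K) (Sum.elim s fun j => {w j}) fun k => by
    refine le_of_eq_of_le ?_ (h k)
    rw [card_filter_sum_eq]
    congr 2
    ext
    simp [eq_comm]
  simp only [Sum.forall, Sum.elim_inl, Sum.elim_inr, Finset.mem_singleton, forall_eq, Sum.inl.injEq,
    Sum.inr.injEq, reduceCtorEq, imp_false] at hP hinj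
  exact ⟨fun i => P (.inl i), fun j => P (.inr j) (w j), hP.1, hP.2,
    fun i k hk => (hinj.1 i k hk).1, fun i k hk => (hinj.1 i k hk).2, fun i j => (hinj.2 i).2 j⟩

theorem isPrimeChain_of_mem_primesOfDegree {v : ExpTuple} {P : ℕ → K[X]}
    (hP : ∀ k ∈ v.degrees, P k ∈ primesOfDegree K k) : IsPrimeChain v fun k => P (v.deg k) where
  monic _ hk := (mem_primesOfDegree.1 (hP _ (ExpTuple.deg_mem_degrees hk))).1
  irreducible _ hk := (mem_primesOfDegree.1 (hP _ (ExpTuple.deg_mem_degrees hk))).2.1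
  natDegree_eq _ hk := (mem_primesOfDegree.1 (hP _ (ExpTuple.deg_mem_degrees hk))).2.2

theorem isFactorization_prod_pow {ι : Type*} [Fintype ι] {P : ι → K[X]} {w e : ι → ℕ}
    (hP : ∀ i, P i ∈ primesOfDegree K (w i)) (hinj : Function.Injective P) (he : ∀ i, 0 < e i) :
    IsFactorization (∏ i, P i ^ e i) P e :=
  ⟨fun i => (mem_primesOfDegree.1 (hP i)).1, fun i => (mem_primesOfDegree.1 (hP i)).2.1, hinj, he,
    Associated.refl _⟩

section

variable {d n : ℕ} {v : Fin n → ExpTuple} {ι κ : Type*} [Fintype ι] [Fintype κ] {U : κ → K[X]}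
  {W : ι → K[X]} {e : ι → ℕ}

theorem occurs_of_isDecomposition {F G F₀ G₀ : K[X]} {A B : Fin n → K[X]} (hF : F.Monic)
    (hG : G.Monic) (h : IsDecomposition d F G v (Fin.cons F₀ A) (Fin.cons G₀ B))
    (hU : IsFactorization F₀ U fun _ => 1) (hW : IsFactorization G₀ W e)
    (hUd : ∀ j, (U j).natDegree ∣ d) (hWd : ∀ j, (e j + 1) * (W j).natDegree ∣ d)
    (heq : (∏ j, (Nat.card K ^ (U j).natDegree - 1)) * (∏ i, (Nat.card K ^ (v i).val 0 - 1)) *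
      ∏ j, (Nat.card K ^ (W j).natDegree - 1) =
        ∏ j, (Nat.card K ^ ((e j + 1) * (W j).natDegree) - 1)) :
    Occurs K d v := by
  have hpos : ∏ j, (Nat.card K ^ (W j).natDegree - 1) ≠ 0 := Finset.prod_ne_zero_iff.2 fun j _ =>
    Nat.sub_ne_zero_of_lt (Nat.one_lt_pow (hW.natDegree_pos j).ne' Finite.one_lt_card)
  refine ⟨F, G, _, _, hF, hG, ?_, h, (mem_exceptionalSet_iff hU hW).2 ⟨fun j => ⟨rfl, hUd j⟩, hWd⟩⟩
  rw [h.phi_eq_sigma_iff hW.ne_zero, Fin.cons_zero, Fin.cons_zero, hU.phi_eq fun _ => rfl]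
  refine Nat.eq_of_mul_eq_mul_right (Nat.pos_of_ne_zero hpos) ?_
  rw [heq, ← hW.prod_mul_sigma_eq, mul_comm]

theorem occurs_of_isPrimeChain {F₀ G₀ : K[X]} {Q : Fin n → ℕ → K[X]} (hv : ∀ i, (v i).val 0 ∣ d)
    (hQ : ∀ i, IsPrimeChain (v i) (Q i))
    (hends : ∀ i j, i ≠ j → Q i ((v i).len + 1) ≠ Q j ((v j).len + 1))
    (hinner : ∀ i j, i ≠ j → ∀ k ∈ Finset.Icc 1 (v i).len, ∀ l ∈ Finset.Icc 1 (v j).len,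
      Q i k ≠ Q j l)
    (hF₀ : F₀.Monic) (hG₀ : G₀.Monic)
    (hU : IsFactorization F₀ U fun _ => 1) (hW : IsFactorization G₀ W e)
    (hQU : ∀ i j, Q i ((v i).len + 1) ≠ U j)
    (hQW : ∀ i, ∀ k ∈ Finset.Icc 1 (v i).len, ∀ j, Q i k ≠ W j)
    (hUd : ∀ j, (U j).natDegree ∣ d) (hWd : ∀ j, (e j + 1) * (W j).natDegree ∣ d)
    (heq : (∏ j, (Nat.card K ^ (U j).natDegree - 1)) * (∏ i, (Nat.card K ^ (v i).val 0 - 1)) *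
      ∏ j, (Nat.card K ^ (W j).natDegree - 1) =
        ∏ j, (Nat.card K ^ ((e j + 1) * (W j).natDegree) - 1)) :
    Occurs K d v := by
  have hlast (i : Fin n) : (v i).len + 1 ∈ Finset.Icc 1 ((v i).len + 1) :=
    Finset.right_mem_Icc.2 (by omega)
  refine occurs_of_isDecomposition ?_ ?_ (isDecomposition_cons hv hQ hends hinner ?_ ?_)
    hU hW hUd hWd heq
  · exact hF₀.mul (monic_prod_of_monic _ _ fun i _ => (hQ i).monic _ (hlast i))
  · exact hG₀.mul (monic_prod_of_monic _ _ fun i _ => monic_prod_of_monic _ _ fun k hk =>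
      ((hQ i).monic k (mem_Icc_len_succ hk)).pow _)
  · intro i hdvd
    obtain ⟨j, hj⟩ := hU.exists_eq_of_monic_of_dvd ((hQ i).monic _ (hlast i))
      ((hQ i).irreducible _ (hlast i)) hdvd
    exact hQU i j hj
  · intro i k hk hdvd
    have hk' := mem_Icc_len_succ hk
    obtain ⟨j, hj⟩ := hW.exists_eq_of_monic_of_dvd ((hQ i).monic k hk')
      ((hQ i).irreducible k hk') hdvd
    exact hQW i k hk j hj

theorem occurs_of_card_le {u : κ → ℕ} {w : ι → ℕ} (hv : ∀ i, (v i).val 0 ∣ d)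
    (hu : ∀ j, u j ∣ d) (he : ∀ j, 0 < e j) (hw : ∀ j, (e j + 1) * w j ∣ d)
    (hend : ∀ i j, (v i).deg ((v i).len + 1) ≠ u j)
    (hcardu : ∀ k, Finset.card {j | u j = k} ≤ (primesOfDegree K k).card)
    (hcard : ∀ k, Finset.card {i | k ∈ (v i).degrees} + Finset.card {j | w j = k} ≤
      (primesOfDegree K k).card)
    (heq : (∏ j, (Nat.card K ^ u j - 1)) * (∏ i, (Nat.card K ^ (v i).val 0 - 1)) *
      ∏ j, (Nat.card K ^ w j - 1) = ∏ j, (Nat.card K ^ ((e j + 1) * w j) - 1)) :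
    Occurs K d v := by
  obtain ⟨U, hU, hUinj⟩ := exists_injective_primes (K := K) u hcardu
  obtain ⟨P, W, hP, hW, hPP, hPW, hWinj⟩ :=
    exists_disjoint_prime_families (K := K) (fun i => (v i).degrees) w hcard
  have hchain (i : Fin n) := isPrimeChain_of_mem_primesOfDegree (hP i)
  have hlast (i : Fin n) : (v i).len + 1 ∈ Finset.Icc 1 ((v i).len + 1) :=
    Finset.right_mem_Icc.2 (by omega)
  have hmem {i k} (hk : k ∈ Finset.Icc 1 (v i).len) : (v i).deg k ∈ (v i).degrees :=
    ExpTuple.deg_mem_degrees (mem_Icc_len_succ hk)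
  have hUdeg (j) : (U j).natDegree = u j := (mem_primesOfDegree.1 (hU j)).2.2
  have hWdeg (j) : (W j).natDegree = w j := (mem_primesOfDegree.1 (hW j)).2.2
  refine occurs_of_isPrimeChain hv hchain
    (fun i j hij h =>
      hij (hPP i _ (ExpTuple.deg_mem_degrees (hlast i)) j _ (ExpTuple.deg_mem_degrees (hlast j)) h))
    (fun i j hij k hk l hl h => hij (hPP i _ (hmem hk) j _ (hmem hl) h))
    (monic_prod_of_monic _ _ fun j _ => (mem_primesOfDegree.1 (hU j)).1.pow _)
    (monic_prod_of_monic _ _ fun j _ => (mem_primesOfDegree.1 (hW j)).1.pow _)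
    (isFactorization_prod_pow hU hUinj fun _ => one_pos) (isFactorization_prod_pow hW hWinj he)
    (fun i j h => hend i j ?_) (fun i k hk j => hPW i _ (hmem hk) j) ?_ ?_ ?_
  · rw [← (hchain i).natDegree_eq _ (hlast i), ← hUdeg j]
    exact congrArg natDegree h
  · simpa only [hUdeg] using hu
  · simpa only [hWdeg] using hw
  · simpa only [hUdeg, hWdeg] using heq

end

end Occurrence

section Applications

open Finset

variable {K : Type*} [Field K]

theorem card_filter_mem_degrees_le [Finite K] {n k : ℕ} (v : Fin n → ExpTuple)
    (h : k ≠ 0 → n ≤ #(primesOfDegree K k)) :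
    #{i | k ∈ (v i).degrees} ≤ #(primesOfDegree K k) := by
  rcases eq_or_ne k 0 with rfl | hk
  · rw [filter_false_of_mem fun _ _ h => (ExpTuple.pos_of_mem_degrees h).false]
    exact Nat.zero_le _
  · exact (card_filter_le _ _).trans ((card_fin n).trans_le (h hk))

theorem card_filter_one_mem_degrees_le {n : ℕ} (v : Fin n → ExpTuple) :
    #{i | 1 ∈ (v i).degrees} ≤ #{i | (v i).val 0 = 1} :=
  card_le_card <| monotone_filter_right _ fun _ _ h =>
    Nat.dvd_one.1 (ExpTuple.val_zero_dvd_of_mem_degrees h)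

theorem card_filter_mem_degrees_of_reduced {n d k : ℕ} {v : Fin n → ExpTuple}
    (hred : ∀ i, (v i).Reduced d) (hk : k ∣ d) :
    #{i | k ∈ (v i).degrees} ≤ #{i | (v i).val 0 = k} :=
  card_le_card <| monotone_filter_right _ fun i _ h => (hred i).eq_val_zero h hk

theorem occurs_of_card_eq_two_of_le_two (hK : Nat.card K = 2) {n : ℕ} (hn : n ≤ 2)
    {v : Fin n → ExpTuple} (hv : ∀ i, (v i).val 0 ∣ 6)
    (h2 : ∀ i j, i ≠ j → ¬ (2 ∈ (v i).degrees ∧ 2 ∈ (v j).degrees)) : Occurs K 6 v := by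
  have : Finite K := Nat.finite_of_card_ne_zero (by omega)
  have hpos (i) : 0 < (v i).val 0 := (v i).val_pos 0 (Nat.zero_le _)
  have hsucc (i) : (v i).val 0 - 1 + 1 = (v i).val 0 := Nat.sub_add_cancel (hpos i)
  -- With `F₀ = 1`, a chain starting in degree `x ≠ 1` is balanced by a linear prime with exponent
  -- `x - 1` in `G₀`.
  refine occurs_of_card_le (κ := Empty) (ι := {i // (v i).val 0 ≠ 1}) (u := Empty.elim)
    (w := fun _ => 1) (e := fun i => (v i).val 0 - 1) hv (by simp) (fun i => ?_) (fun i => ?_)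
    (by simp) (by simp) (fun k => ?_) ?_
  · have := hpos i
    have := i.2
    omega
  · rw [hsucc, mul_one]
    exact hv i
  · by_cases hk₁ : k = 1
    · subst hk₁
      have hsplit : #{i | (v i).val 0 = 1} + #{i | (v i).val 0 ≠ 1} = n := by
        rw [card_filter_add_card_filter_not, card_fin]
      have hle := card_filter_one_mem_degrees_le v
      simp only [filter_true, card_univ, Fintype.card_subtype, card_primesOfDegree_one, hK]
      omega
    rw [filter_false_of_mem fun _ _ => Ne.symm hk₁, card_empty, add_zero]
    by_cases hk₂ : k = 2
    · rw [hk₂, card_primesOfDegree_two hK, card_le_one]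
      exact fun i hi j hj => by_contra fun hij =>
        h2 i j hij ⟨(mem_filter.1 hi).2, (mem_filter.1 hj).2⟩
    · exact card_filter_mem_degrees_le v fun hk₀ =>
        hn.trans (two_le_card_primesOfDegree_of_ne_two hK hk₀ hk₂)
  · simp only [univ_eq_empty, prod_empty, one_mul, hK, pow_one, Nat.add_one_sub_one, prod_const_one,
      mul_one, hsucc]
    refine Eq.symm <|
      Fintype.prod_of_injective _ Subtype.val_injective _ _ (fun i hi => ?_) fun _ => rfl
    have hi' : (v i).val 0 = 1 := by simpa using hi
    rw [hi']
    rfl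

/-- The witnesses express `3 * ∏ i, (2 ^ x i - 1)` as a product of the quotients
`(2 ^ ((e + 1) * w) - 1) / (2 ^ w - 1)`, which are `63, 7, 21, 9` for
`(w, e) = (1, 5), (1, 2), (2, 2), (3, 1)`. -/
theorem exists_balancing_exponents {x : Fin 3 → ℕ} (hx : ∀ i, x i ∣ 6) (hx₂ : x 2 = 1)
    (h22 : ¬ (x 0 = 2 ∧ x 1 = 2)) (h11 : ¬ (x 0 = 1 ∧ x 1 = 1)) :
    ∃ (m : ℕ) (w e : Fin m → ℕ), (∀ j, 0 < e j) ∧ (∀ j, (e j + 1) * w j ∣ 6) ∧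
      (∀ k ∈ Nat.divisors 6, #{i | x i = k} + #{j | w j = k} ≤ if k = 2 then 1 else 2) ∧
      3 * (∏ i, (2 ^ x i - 1)) * ∏ j, (2 ^ w j - 1) = ∏ j, (2 ^ ((e j + 1) * w j) - 1) := by
  obtain ⟨a, b, rfl⟩ : ∃ a b, x = ![a, b, 1] :=
    ⟨x 0, x 1, by ext i; fin_cases i <;> simp [hx₂]⟩
  have ha : a ∈ Nat.divisors 6 := Nat.mem_divisors.2 ⟨hx 0, by norm_num⟩
  have hb : b ∈ Nat.divisors 6 := Nat.mem_divisors.2 ⟨hx 1, by norm_num⟩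
  rw [show Nat.divisors 6 = {1, 2, 3, 6} by decide] at ha hb
  simp only [mem_insert, mem_singleton] at ha hb
  rcases ha with rfl | rfl | rfl | rfl <;> rcases hb with rfl | rfl | rfl | rfl
  · exact absurd ⟨rfl, rfl⟩ h11
  · exact ⟨1, ![3], ![1], by decide⟩
  · exact ⟨1, ![2], ![2], by decide⟩
  · exact ⟨2, ![2, 3], ![2, 1], by decide⟩
  · exact ⟨1, ![3], ![1], by decide⟩
  · exact absurd ⟨rfl, rfl⟩ h22
  · exact ⟨1, ![1], ![5], by decide⟩
  · exact ⟨2, ![1, 3], ![5, 1], by decide⟩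
  · exact ⟨1, ![2], ![2], by decide⟩
  · exact ⟨1, ![1], ![5], by decide⟩
  · exact ⟨2, ![1, 2], ![2, 2], by decide⟩
  · exact ⟨2, ![1, 2], ![5, 2], by decide⟩
  · exact ⟨2, ![2, 3], ![2, 1], by decide⟩
  · exact ⟨2, ![1, 3], ![5, 1], by decide⟩
  · exact ⟨2, ![1, 2], ![5, 2], by decide⟩
  · exact ⟨3, ![1, 2, 3], ![5, 2, 1], by decide⟩

theorem occurs_of_card_eq_two_of_reduced (hK : Nat.card K = 2) {v : Fin 3 → ExpTuple}
    (hv : ∀ i, (v i).val 0 ∣ 6) (hred : ∀ i, (v i).Reduced 6) (hv₂ : (v 2).val 0 = 1)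
    (h22 : ¬ ((v 0).val 0 = 2 ∧ (v 1).val 0 = 2)) (h11 : ¬ ((v 0).val 0 = 1 ∧ (v 1).val 0 = 1)) :
    Occurs K 6 v := by
  have : Finite K := Nat.finite_of_card_ne_zero (by omega)
  obtain ⟨m, w, e, he, hw, hcard, heq⟩ := exists_balancing_exponents hv hv₂ h22 h11
  refine occurs_of_card_le (κ := Unit) (u := fun _ => 2) hv (by decide) he hw (fun i _ h => ?_)
    (fun k => ?_) (fun k => ?_) ?_
  · have := (v i).one_le_len
    exact (hred i).not_deg_dvd (k := (v i).len + 1) (by omega) (h ▸ by norm_num)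
  · by_cases hk : 2 = k
    · rw [← hk, card_primesOfDegree_two hK]
      rfl
    · simp [hk]
  · by_cases hk : k ∣ 6
    · refine (Nat.add_le_add_right (card_filter_mem_degrees_of_reduced hred hk) _).trans
        ((hcard k (Nat.mem_divisors.2 ⟨hk, by norm_num⟩)).trans ?_)
      split_ifs with hk₂
      · rw [hk₂, card_primesOfDegree_two hK]
      · exact two_le_card_primesOfDegree_of_ne_two hK (ne_zero_of_dvd_ne_zero (by norm_num) hk) hk₂
    · have hw_ne (j) : w j ≠ k := fun h => hk (h ▸ dvd_of_mul_left_dvd (hw j))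
      simp only [hw_ne, filter_false, card_empty, add_zero]
      refine card_filter_mem_degrees_le v fun hk₀ => three_le_card_primesOfDegree hK ?_
      by_contra! hk₄
      obtain rfl | rfl | rfl : k = 1 ∨ k = 2 ∨ k = 3 := by omega
      all_goals exact hk (by norm_num)
  · simpa [hK] using heq

theorem prod_three_pow_sub_one {ι : Type*} [Fintype ι] {x : ι → ℕ}
    (hx : ∀ i, x i = 1 ∨ x i = 2) :
    ∏ i, (3 ^ x i - 1) = 2 ^ (Fintype.card ι + 2 * #{i | x i = 2}) := by
  have hterm (i) : 3 ^ x i - 1 = 2 * if x i = 2 then 2 ^ 2 else 1 := by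
    rcases hx i with h | h <;> rw [h] <;> rfl
  simp only [hterm, prod_mul_distrib, prod_const, card_univ, prod_ite, one_pow, mul_one, pow_add,
    pow_mul]

theorem occurs_of_card_eq_three (hK : Nat.card K = 3) {n : ℕ} (hn : n ≤ 2) {v : Fin n → ExpTuple}
    (hv : ∀ i, (v i).val 0 ∣ 2) : Occurs K 2 v := by
  have : Finite K := Nat.finite_of_card_ne_zero (by omega)
  set s := #{i | (v i).val 0 = 2} with hs
  set t := #{i | (v i).val 0 = 1} with ht
  have hval (i) : (v i).val 0 = 1 ∨ (v i).val 0 = 2 := (Nat.dvd_prime Nat.prime_two).1 (hv i)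
  have hst : t + s = n := by
    rw [ht, hs, ← card_union_of_disjoint, ← filter_or, filter_true_of_mem fun i _ => hval i,
      card_fin]
    exact disjoint_filter.2 fun _ _ h => by omega
  -- All factors of the equation are powers of `2`, so linear primes in `F₀` (factor `2`) and in
  -- `G₀` (exponent `1`, factor `(3 ^ 2 - 1) / (3 - 1) = 2 ^ 2`) only have to match the
  -- total exponent.
  refine occurs_of_card_le (κ := Fin (n % 2)) (ι := Fin ((n + 1) / 2 + s)) (u := fun _ => 1)
    (w := fun _ => 1) (e := fun _ => 1) hv (by simp) (by simp) (by simp)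
    (fun i _ h => ?_) (fun k => ?_) (fun k => ?_) ?_
  · have := (v i).val_zero_lt_deg_len_succ
    have := (v i).val_pos 0 (Nat.zero_le _)
    omega
  · by_cases hk : 1 = k
    · subst hk
      simp only [filter_true, card_univ, Fintype.card_fin, card_primesOfDegree_one, hK]
      omega
    · simp [hk]
  · by_cases hk : k = 1
    · subst hk
      have hle := card_filter_one_mem_degrees_le v
      simp only [filter_true, card_univ, Fintype.card_fin, card_primesOfDegree_one, hK]
      omega
    · rw [filter_false_of_mem fun _ _ => Ne.symm hk, card_empty, add_zero]
      exact card_filter_mem_degrees_le v fun hk₀ =>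
        hn.trans (two_le_card_primesOfDegree hK hk₀)
  · rw [hK, prod_three_pow_sub_one hval, ← hs, Fintype.card_fin]
    simp only [prod_const, card_fin]
    rw [show 3 ^ 1 - 1 = 2 from rfl, show 3 ^ ((1 + 1) * 1) - 1 = 2 ^ 3 from rfl, ← pow_add,
      ← pow_add, ← pow_mul]
    congr 1
    omega

end Applications

end PhiSigma

theorem mainTheorem3 (K : Type*) [Field K] [Finite K] :
    (Nat.card K = 3 →
      PhiSigma.HasDecompositions K 2 ∧
      (∀ F G : K[X], F ≠ 0 → G ≠ 0 → PhiSigma.phi K F = PhiSigma.sigma K G →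
        ∀ (n : ℕ) (v : Fin n → PhiSigma.ExpTuple) (A B : Fin (n + 1) → K[X]),
          PhiSigma.IsDecomposition 2 F G v A B → n ≤ 2) ∧
      (∀ n ≤ 2, ∀ v : Fin n → PhiSigma.ExpTuple, (∀ i, (v i).val 0 ∣ 2) →
        PhiSigma.Occurs K 2 v)) ∧
    (Nat.card K = 2 →
      PhiSigma.HasDecompositions K 6 ∧
      (∀ F G : K[X], F ≠ 0 → G ≠ 0 → PhiSigma.phi K F = PhiSigma.sigma K G →
        ∀ (n : ℕ) (v : Fin n → PhiSigma.ExpTuple) (A B : Fin (n + 1) → K[X]),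
          PhiSigma.IsDecomposition 6 F G v A B →
            n ≤ 3 ∧
            (∀ i j, i ≠ j → ¬ ((v i).val 0 = 2 ∧ (v j).val 0 = 2)) ∧
            ¬ (n = 3 ∧ ∀ i, (v i).val 0 = 1)) ∧
      (∀ n ≤ 1, ∀ v : Fin n → PhiSigma.ExpTuple, (∀ i, (v i).val 0 ∣ 6) →
        PhiSigma.Occurs K 6 v) ∧
      (∀ v : Fin 2 → PhiSigma.ExpTuple, (∀ i, (v i).val 0 ∣ 6) → (∀ i, (v i).Reduced 6) →
        ¬ ((v 0).val 0 = 2 ∧ (v 1).val 0 = 2) →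
        PhiSigma.Occurs K 6 v) ∧
      (∀ v : Fin 3 → PhiSigma.ExpTuple, (∀ i, (v i).val 0 ∣ 6) → (∀ i, (v i).Reduced 6) →
        (v 2).val 0 = 1 →
        ¬ ((v 0).val 0 = 2 ∧ (v 1).val 0 = 2) →
        ¬ ((v 0).val 0 = 1 ∧ (v 1).val 0 = 1) →
        PhiSigma.Occurs K 6 v)) := by
  refine ⟨fun hK => ⟨?_, ?_, ?_⟩, fun hK => ⟨?_, ?_, ?_, ?_, ?_⟩⟩
  · exact PhiSigma.hasDecompositions two_ne_zero (PhiSigma.isZsigmondyBound_of_three_le hK.ge)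
  · exact fun F G hF hG hFG n v A B h => h.le_two_of_card_eq_three hK hF hG hFG
  · exact fun n hn v hv => PhiSigma.occurs_of_card_eq_three hK hn hv
  · exact PhiSigma.hasDecompositions (by norm_num) (hK ▸ PhiSigma.isZsigmondyBound_two)
  · exact fun F G hF hG hFG n v A B h => ⟨h.le_three_of_card_eq_two hK hF hG hFG,
      fun i j hij => h.not_val_eq_two_of_ne hK hG hij,
      fun ⟨hn, hv⟩ => absurd (h.le_card_of_forall_val_eq_one hG hv) (by simp [hn, hK])⟩
  · intro n hn v hv
    have : Subsingleton (Fin n) := Fin.subsingleton_iff_le_one.2 hn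
    exact PhiSigma.occurs_of_card_eq_two_of_le_two hK (by omega) hv fun i j hij =>
      absurd (Subsingleton.elim i j) hij
  · intro v hv hred h22
    refine PhiSigma.occurs_of_card_eq_two_of_le_two hK le_rfl hv fun i j hij ⟨hi, hj⟩ => ?_
    have hi₂ := (hred i).eq_val_zero hi (by norm_num)
    have hj₂ := (hred j).eq_val_zero hj (by norm_num)
    obtain ⟨rfl, rfl⟩ | ⟨rfl, rfl⟩ : i = 0 ∧ j = 1 ∨ i = 1 ∧ j = 0 := by omega
    · exact h22 ⟨hi₂, hj₂⟩
    · exact h22 ⟨hj₂, hi₂⟩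
  · exact fun v hv hred hv₂ h22 h11 =>
      PhiSigma.occurs_of_card_eq_two_of_reduced hK hv hred hv₂ h22 h11
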